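/- Fix $\varphi\in C_0^\infty(\{1/2<|\zeta|<2\})$ and $\chi\in C_0^\infty(\{|\zeta|<2\})$, real-valued on $\mathbb{R}^2$, with $\chi(\zeta)+\sum_{j\ge 1}\varphi(2^{-j}\zeta)=1$ for all $\zeta=(\xi,\eta)\in\mathbb{R}^2$. For a dyadic integer $\lambda=2^j$, $j\ge 0$, let $u_\lambda=\Delta_\lambda u$, where $\widehat{\Delta_1u}=\chi\,\widehat u$ and $\widehat{\Delta_\lambda u}=\varphi(\cdot/\lambda)\,\widehat u$ for $\lambda\ge 2$. Let $W^{1,\infty}_{xy}(\mathbb{R}^2)$ be the closure of the Schwartz functions in the norm $\|f\|_{L^\infty}+\|\nabla f\|_{L^\infty}$, with $\|\nabla f\|_{L^\infty}=\|\partial_xf\|_{L^\infty}+\|\partial_yf\|_{L^\infty}$. Lemma 6.5. Let $1<\delta<k$. There is a constant $C>0$, depending only on $\delta$, $k$, $\varphi$, $\chi$, such that the following holds. Let $0<\alpha\le 1$, $s>s_\alpha:=\frac32+\frac14(1-\alpha)$, $T>0$, and let the real-valued function $u\in C([0,T];H^s(\mathbb{R}^2))\cap L^1([0,T];W^{1,\infty}_{xy}(\mathbb{R}^2))$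 be a solution, in the sense of distributions, of $$u_t+D_x^\alpha u_x+\mathcal{H}u_{yy}+uu_x=0\quad\text{on }[0,T],$$ where $D_x^\alpha$ and $\mathcal{H}$ are the Fourier multipliers with symbols $|\xi|^\alpha$ and $-i\,\mathrm{sgn}(\xi)$. Let $(w_\lambda)$ be positive numbers, indexed by the dyadic integers $\lambda=2^j$, $j\ge0$, with $\delta w_\lambda\le w_{2\lambda}\le k\,w_\lambda$ for every $\lambda$ and $\sum_\lambda w_\lambda^2\|u_\lambda(0)\|_{L^2}^2<\infty$. Then $\sum_\lambda w_\lambda^2\|u_\lambda(t)\|_{L^2}^2<\infty$ for every $t\in[0,T]$, and for all $\tau,t\in[0,T]$ $$\sum_\lambda w_\lambda^2\|u_\lambda(t)\|_{L^2}^2\;\le\; C\exp\bigl(C\|\nabla u\|_{L^1_IL^\infty_{xy}}\bigr)\sum_\lambda w_\lambda^2\|u_\lambda(\tau)\|_{L^2}^2,$$ where $I$ is the closed interval with endpoints $\tau$ and $t$. -/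

import Mathlib

open MeasureTheory Set
open scoped ENNReal SchwartzMap FourierTransform LineDeriv ZeroAtInfty ContDiff

noncomputable section

namespace BO2

/-- The plane `ℝ²`; the coordinates of a point `z` are `x = z 0` and `y = z 1`, those of a
frequency `ζ` are `ξ = ζ 0` and `η = ζ 1`. -/
abbrev Plane : Type := EuclideanSpace ℝ (Fin 2)

/-- The unit vectors of the plane in the directions `x` (`i = 0`) and `y` (`i = 1`). -/
def e (i : Fin 2) : Plane := EuclideanSpace.single i 1

/-- Real `L²` functions on the plane. -/
abbrev L2R : Type := Lp ℝ 2 (volume : Measure Plane)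

/-- Complex `L²` functions on the plane. -/
abbrev L2C : Type := Lp ℂ 2 (volume : Measure Plane)

/-- A real `L²` function, regarded as a complex one. -/
def toComplex (f : L2R) : L2C := Complex.ofRealCLM.compLp f

/-! ### Littlewood-Paley decomposition

Fourier symbols are written as functions of the angular frequency `ζ`, that is, for the Fourier
transform `∫ exp (-i z ⋅ ζ) f z dz`. The transform `𝓕` has the kernel `exp (-2πi z ⋅ ζ)`,
so a symbol `m` acts as multiplication of `𝓕 f ζ` by `m (2π ζ)`. -/

/-- A smooth dyadic partition of unity: `φ ∈ C₀^∞ (1/2 < |ζ| < 2)`, `χ ∈ C₀^∞ (|ζ| < 2)` and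
`χ ζ + ∑_{k ≥ 1} φ (ζ / 2 ^ k) = 1` for every `ζ`. -/
structure DyadicPartition where
  φ : Plane → ℝ
  χ : Plane → ℝ
  contDiff_φ : ContDiff ℝ ∞ φ
  contDiff_χ : ContDiff ℝ ∞ χ
  tsupport_φ : tsupport φ ⊆ {ζ | 1 / 2 < ‖ζ‖ ∧ ‖ζ‖ < 2}
  tsupport_χ : tsupport χ ⊆ {ζ | ‖ζ‖ < 2}
  hasSum_one : ∀ ζ, HasSum (fun k : ℕ => φ (((2 : ℝ) ^ (k + 1))⁻¹ • ζ)) (1 - χ ζ)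

namespace DyadicPartition

variable (P : DyadicPartition)

/-- The symbol of `Δ_λ` for `λ = 2 ^ j`: it is `χ` for `λ = 1` and `φ (ζ / λ)` for `λ ≥ 2`. -/
def symbol (j : ℕ) (ζ : Plane) : ℝ :=
  if j = 0 then P.χ ζ else P.φ (((2 : ℝ) ^ j)⁻¹ • ζ)

theorem hasCompactSupport_of_subset {g : Plane → ℝ} (h : tsupport g ⊆ {ζ | ‖ζ‖ < 2}) :
    HasCompactSupport g :=
  (isCompact_closedBall (0 : Plane) 2).of_isClosed_subset (isClosed_tsupport g) fun ζ hζ => by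
    simpa using (h hζ : ‖ζ‖ < 2).le

theorem memLp_top_comp {g : Plane → ℝ} (hg : Continuous g) (h : tsupport g ⊆ {ζ | ‖ζ‖ < 2})
    (c : ℝ) : MemLp (fun ζ => ((g (c • ζ) : ℝ) : ℂ)) ∞ (volume : Measure Plane) := by
  obtain ⟨M, hM⟩ := (hasCompactSupport_of_subset h).exists_bound_of_continuous hg
  refine memLp_top_of_bound (Continuous.aestronglyMeasurable (by fun_prop)) M
    (Filter.Eventually.of_forall fun ζ => ?_)
  simpa using hM (c • ζ)

theorem memLp_symbol (j : ℕ) :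
    MemLp (fun ζ => ((P.symbol j ((2 * Real.pi) • ζ) : ℝ) : ℂ)) ∞ (volume : Measure Plane) := by
  by_cases hj : j = 0
  · simpa [symbol, hj] using memLp_top_comp P.contDiff_χ.continuous P.tsupport_χ (2 * Real.pi)
  · simpa [symbol, hj, smul_smul] using memLp_top_comp P.contDiff_φ.continuous
      (P.tsupport_φ.trans fun ζ hζ => hζ.2) (((2 : ℝ) ^ j)⁻¹ * (2 * Real.pi))

/-- The Littlewood-Paley operator `Δ_λ`, `λ = 2 ^ j`, on `L²`: the Fourier multiplier with the
symbol `P.symbol j`. -/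
def block (j : ℕ) (f : L2C) : L2C :=
  𝓕⁻ ((P.memLp_symbol j).toLp _ • 𝓕 f : L2C)

end DyadicPartition

/-! ### The space `W^{1,∞}` -/

/-- Triples of continuous functions vanishing at infinity, with the supremum norms. -/
abbrev Jet : Type := C₀(Plane, ℝ) × C₀(Plane, ℝ) × C₀(Plane, ℝ)

/-- The map `f ↦ (f, ∂ₓ f, ∂_y f)` on Schwartz functions. -/
def schwartzJet (f : 𝓢(Plane, ℝ)) : Jet :=
  (f.toZeroAtInfty, (∂_{e 0} f).toZeroAtInfty, (∂_{e 1} f).toZeroAtInfty)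

/-- `W^{1,∞}`, the closure of the Schwartz functions in the norm `‖f‖_∞ + ‖∂ₓ f‖_∞ + ‖∂_y f‖_∞`.
A member `f` is represented by the triple `(f, ∂ₓ f, ∂_y f)`, and the norm of triples is the
equivalent one given by the largest of the three supremum norms. -/
def W1Inf : Set Jet := closure (range schwartzJet)

/-- `‖∇ f‖_∞ = ‖∂ₓ f‖_∞ + ‖∂_y f‖_∞` for a member `(f, ∂ₓ f, ∂_y f)` of `W^{1,∞}`. -/
def gradNorm (F : Jet) : ℝ := ‖F.2.1‖ + ‖F.2.2‖

/-! ### The equation -/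

/-- The symbol of `D_x^α ∂ₓ + 𝓗 ∂_y²`, where `D_x^α` has the symbol `|ξ|^α` and the Hilbert
transform `𝓗` in `x` has the symbol `-i sgn ξ`. -/
def dispersionSymbol (α : ℝ) (ζ : Plane) : ℂ :=
  ((|ζ 0| ^ α : ℝ) : ℂ) * (Complex.I * (ζ 0 : ℂ)) +
    (-Complex.I * (Real.sign (ζ 0) : ℂ)) * (Complex.I * (ζ 1 : ℂ)) ^ 2

/-- `(D_x^α ∂ₓ + 𝓗 ∂_y²) ψ` for a Schwartz function `ψ`. -/
def dispersion (α : ℝ) (ψ : 𝓢(Plane, ℂ)) : Plane → ℂ :=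
  𝓕⁻ fun ζ : Plane => dispersionSymbol α ((2 * Real.pi) • ζ) * (𝓕 ψ) ζ

/-- The pairing of `-((D_x^α ∂ₓ + 𝓗 ∂_y²) f + f ∂ₓ f)` with a test function `ψ`: the operator
`D_x^α ∂ₓ + 𝓗 ∂_y²` is antisymmetric for the bilinear pairing `∫ f ψ`, and
`f ∂ₓ f = ∂ₓ (f ^ 2) / 2`. -/
def weakRHS (α : ℝ) (f : L2R) (ψ : 𝓢(Plane, ℂ)) : ℂ :=
  ∫ z, ((f z : ℂ) * dispersion α ψ z + (1 / 2 : ℂ) * (f z : ℂ) ^ 2 * (∂_{e 0} ψ) z)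

/-- `u` belongs to `C([0,T]; H^s)`: the Bessel potential `J^s u(t)` is a continuous function of `t`
with values in `L²`. -/
def ContinuousInHs (s T : ℝ) (u : ℝ → L2R) : Prop :=
  ∃ v : ℝ → L2C, ContinuousOn v (Icc 0 T) ∧ ∀ t ∈ Icc 0 T,
    TemperedDistribution.besselPotential Plane ℂ s (toComplex (u t) : 𝓢'(Plane, ℂ)) =
      (v t : 𝓢'(Plane, ℂ))

/-- The function `u` belongs to `C([0,T]; H^s) ∩ L¹([0,T]; W^{1,∞})`, where `U` is `u` regarded as a
(Bochner integrable) function with values in `W^{1,∞}` at almost every time, and it solves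
`∂ₜ u + D_x^α ∂ₓ u + 𝓗 ∂_y² u + u ∂ₓ u = 0` on `[0,T]` in the sense of distributions (since `u` is
continuous in time, the equation may be integrated in time and tested with functions of `(x, y)`). -/
structure IsSolution (α s T : ℝ) (u : ℝ → L2R) (U : ℝ → Jet) : Prop where
  continuousInHs : ContinuousInHs s T u
  integrableOn : IntegrableOn U (Icc 0 T)
  mem_W1Inf : ∀ᵐ t, t ∈ Icc 0 T → U t ∈ W1Inf
  ae_eq : ∀ᵐ t, t ∈ Icc 0 T → (u t : Plane → ℝ) =ᵐ[volume] (U t).1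
  weak_eq : ∀ ψ : 𝓢(Plane, ℂ), ∀ t ∈ Icc 0 T,
    (∫ z, (u t z : ℂ) * ψ z) - ∫ z, (u 0 z : ℂ) * ψ z = ∫ r in (0 : ℝ)..t, weakRHS α (u r) ψ

/-- The terms `w_λ² ‖Δ_λ f‖²_{L²}`, `λ = 2 ^ j`; here `w j` is the weight `w_λ`. -/
def weightedEnergy (P : DyadicPartition) (w : ℕ → ℝ) (f : L2R) (j : ℕ) : ℝ :=
  w j ^ 2 * ‖P.block j (toComplex f)‖ ^ 2

end BO2

end

noncomputable section

namespace BO2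

/-! ### The Fourier transform on `L²` and as an integral -/

/-! The proof is an energy estimate on each dyadic block, summed against the weights. Localized to
one block, the dispersive symbol is bounded, so the weak equation becomes an ODE in `L²`
(`IsSolution.block_eq`). That symbol is purely imaginary, so the dispersive term drops out of the
derivative of `‖Δ_λ u‖²`, and only the pairing of `Δ_λ u` with `Δ_λ (u²/2)_x` remains
(`IsSolution.norm_block_sq_sub`).

The core is the bound of this pairing in `exists_enorm_re_integral_nonlinear_le`. Let `g` be the
part of `u` at frequencies far below `λ`. Neither `g` nor `g²` is seen by `Δ_λ`, so with `h = u - g`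
and `q = (u + g)/2` the pairing is that of `Δ_λ h` with `∂ₓ Δ_λ (q h)`. Moving `q` out of `Δ_λ`
costs a commutator bounded by the Lipschitz constant of `q`. In the remaining term an integration by
parts puts the derivative on `q`. The result is `C ‖∇u‖_∞ ‖h‖²`, and `‖h‖²` is controlled by the
blocks of frequency at least about `λ`, with no loss of derivatives.

After multiplication by `w_λ²` and exchange of the sums, block `μ` collects `∑ w_λ²` over `λ ≤ 8 μ`.
This is comparable to `w_μ²`: the lower growth bound `δ > 1` makes the sum geometric, and the upper
bound `k` absorbs the factor `8` (`tsum_weight_sq_le`). Hence the weighted energy satisfies an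
integral inequality of Gronwall type, in both time directions (`exists_energy_le`).

Gronwall's inequality needs an energy known in advance to be bounded. Therefore the weights are
first continued geometrically beyond an index `N`, with a ratio at most `3/2`. The `H^s` bound with
`s ≥ 3/2` then makes the energy bounded in time (`energy_le_of_le`). The constants do not depend on
`N`, and partial sums of the original energy see only the unmodified weights, so the estimate passes
to `w`. -/

theorem integral_fourier_mul_schwartz (f : L2C) (ψ : 𝓢(Plane, ℂ)) :
    ∫ z, (𝓕 f : L2C) z * ψ z = ∫ z, f z * (𝓕 ψ) z := by
  have h := DFunLike.congr_fun (Lp.fourier_toTemperedDistribution_eq f) ψ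
  rw [TemperedDistribution.fourier_apply, Lp.toTemperedDistribution_apply,
    Lp.toTemperedDistribution_apply] at h
  simpa [smul_eq_mul, mul_comm] using h.symm

theorem integral_fourierInv_mul_schwartz (f : L2C) (ψ : 𝓢(Plane, ℂ)) :
    ∫ z, (𝓕⁻ f : L2C) z * ψ z = ∫ z, f z * (𝓕⁻ ψ) z := by
  have h := DFunLike.congr_fun (Lp.fourierInv_toTemperedDistribution_eq f) ψ
  rw [TemperedDistribution.fourierInv_apply, Lp.toTemperedDistribution_apply,
    Lp.toTemperedDistribution_apply] at h
  simpa [smul_eq_mul, mul_comm] using h.symm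

theorem integral_fourier_mul {F G : Plane → ℂ} (hF : Integrable F) (hG : Integrable G) :
    ∫ z, (𝓕 F) z * G z = ∫ z, F z * (𝓕 G) z := by
  have h := VectorFourier.integral_fourierIntegral_smul_eq_flip (L := innerₗ Plane)
    Real.continuous_fourierChar continuous_inner hF hG
  rw [flip_innerₗ] at h
  exact h

theorem continuous_fourier {F : Plane → ℂ} (hF : Integrable F) : Continuous (𝓕 F) :=
  VectorFourier.fourierIntegral_continuous Real.continuous_fourierChar
    (L := innerₗ Plane) continuous_inner hF

theorem continuous_fourierInv {F : Plane → ℂ} (hF : Integrable F) : Continuous (𝓕⁻ F) := by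
  rw [Real.fourierInv_eq_fourier_comp_neg]
  exact continuous_fourier hF.comp_neg

theorem integral_fourierInv_mul {F G : Plane → ℂ} (hF : Integrable F) (hG : Integrable G) :
    ∫ z, (𝓕⁻ F) z * G z = ∫ z, F z * (𝓕⁻ G) z := by
  rw [Real.fourierInv_eq_fourier_comp_neg, integral_fourier_mul hF.comp_neg hG,
    ← integral_neg_eq_self]
  simp [← Real.fourierInv_eq_fourier_neg]

theorem ae_eq_of_integral_mul_schwartz_eq {F G : Plane → ℂ} (hF : LocallyIntegrable F)
    (hG : LocallyIntegrable G)
    (h : ∀ ψ : 𝓢(Plane, ℂ), ∫ z, F z * ψ z = ∫ z, G z * ψ z) : F =ᵐ[volume] G := by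
  refine ae_eq_of_integral_contDiff_smul_eq hF hG fun g hg hgc => ?_
  have h₁ : HasCompactSupport (Complex.ofRealCLM ∘ g) := hgc.comp_left rfl
  have h₂ : ContDiff ℝ ∞ (Complex.ofRealCLM ∘ g) := by fun_prop
  simpa [mul_comm, Complex.real_smul] using h (h₁.toSchwartzMap h₂)

/-- Both transforms obey the same duality formula against Schwartz functions, which determines a
locally integrable function almost everywhere. -/
theorem fourierInv_toLp_ae_eq (F : L2C) (hF : Integrable F) :
    ((𝓕⁻ F : L2C) : Plane → ℂ) =ᵐ[volume] 𝓕⁻ (F : Plane → ℂ) := by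
  refine ae_eq_of_integral_mul_schwartz_eq ((Lp.memLp _).locallyIntegrable (by norm_num))
    (continuous_fourierInv hF).locallyIntegrable fun ψ => ?_
  rw [integral_fourierInv_mul_schwartz, integral_fourierInv_mul hF ψ.integrable,
    SchwartzMap.fourierInv_coe]

theorem fourier_toLp_ae_eq (F : L2C) (hF : Integrable F) :
    ((𝓕 F : L2C) : Plane → ℂ) =ᵐ[volume] 𝓕 (F : Plane → ℂ) := by
  refine ae_eq_of_integral_mul_schwartz_eq ((Lp.memLp _).locallyIntegrable (by norm_num))
    (continuous_fourier hF).locallyIntegrable fun ψ => ?_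
  rw [integral_fourier_mul_schwartz, integral_fourier_mul hF ψ.integrable,
    SchwartzMap.fourier_coe]

/-- The bilinear pairing of `L²` functions. -/
def pair (f g : L2C) : ℂ := ∫ z, f z * g z

theorem pair_eq_inner (f g : L2C) :
    pair f g = inner ℂ (star f) g := by
  rw [L2.inner_def]
  refine integral_congr_ae ?_
  filter_upwards [Lp.coeFn_star f] with z hz
  simp [hz, mul_comm]

theorem continuous_pair_right (f : L2C) : Continuous (pair f) := by
  have : pair f = fun g => inner ℂ (star f) g := funext fun g => pair_eq_inner f g
  rw [this]
  exact continuous_const.inner continuous_id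

/-- Both sides are continuous in `g`, and for Schwartz `g` this is the definition of the transform
by duality; Schwartz functions are dense in `L²`. -/
theorem pair_fourier (f g : L2C) : pair (𝓕 f : L2C) g = pair f (𝓕 g : L2C) := by
  refine DenseRange.induction_on
    (p := fun g : L2C => pair (𝓕 f : L2C) g = pair f (𝓕 g : L2C))
    (SchwartzMap.denseRange_toLpCLM (F := ℂ) (p := 2) (μ := (volume : Measure Plane))
      ENNReal.ofNat_ne_top) g ?_ fun ψ => ?_
  · refine isClosed_eq (continuous_pair_right _) ((continuous_pair_right f).comp ?_)
    exact FourierTransform.continuous_fourier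
  · have h1 : pair (𝓕 f : L2C) (ψ.toLp 2) = ∫ z, (𝓕 f : L2C) z * ψ z := by
      refine integral_congr_ae ?_
      filter_upwards [ψ.coeFn_toLp 2 volume] with z hz
      rw [hz]
    have h2 : pair f ((𝓕 ψ).toLp 2) = ∫ z, f z * (𝓕 ψ) z := by
      refine integral_congr_ae ?_
      filter_upwards [(𝓕 ψ).coeFn_toLp 2 volume] with z hz
      rw [hz]
    change pair (𝓕 f : L2C) (ψ.toLp 2) = pair f (𝓕 (ψ.toLp 2) : L2C)
    rw [SchwartzMap.toLp_fourier_eq, h1, h2, integral_fourier_mul_schwartz]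

theorem eq_of_pair_schwartz {f g : L2C}
    (h : ∀ ψ : 𝓢(Plane, ℂ), ∫ z, f z * ψ z = ∫ z, g z * ψ z) : f = g :=
  Lp.ext (ae_eq_of_integral_mul_schwartz_eq ((Lp.memLp _).locallyIntegrable (by norm_num))
    ((Lp.memLp _).locallyIntegrable (by norm_num)) h)

end BO2

namespace BO2

/-! ### Convolution in `L²` -/

/-- Cauchy-Schwarz for the factorization `a b = a^(1/2) · (a^(1/2) b)`. -/
theorem sq_lintegral_mul_le {X : Type*} [MeasurableSpace X] {μ : Measure X}
    {a b : X → ℝ≥0∞} (ha : AEMeasurable a μ) (hb : AEMeasurable b μ) :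
    (∫⁻ x, a x * b x ∂μ) ^ 2 ≤ (∫⁻ x, a x ∂μ) * ∫⁻ x, a x * b x ^ 2 ∂μ := by
  have h := ENNReal.lintegral_mul_le_Lp_mul_Lq μ Real.HolderConjugate.two_two
    (ha.pow_const (1 / 2 : ℝ)) ((ha.pow_const (1 / 2 : ℝ)).mul hb)
  have e : ∀ x : ℝ≥0∞, x ^ (1 / 2 : ℝ) * x ^ (1 / 2 : ℝ) = x := fun x => by
    rw [← ENNReal.rpow_add_of_nonneg _ _ (by norm_num) (by norm_num)]; norm_num
  have e2 : ∀ x : ℝ≥0∞, (x ^ (1 / 2 : ℝ)) ^ 2 = x := fun x => by rw [sq, e]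
  simp only [Pi.mul_apply, ← mul_assoc, e, ENNReal.rpow_two, mul_pow, e2] at h
  calc _ ≤ _ := pow_le_pow_left' h 2
    _ = _ := by rw [mul_pow, e2, e2]

/-- Young's inequality `L¹ * L² → L²`, from Cauchy-Schwarz with weight `a (z - ·)` and Tonelli. With
values in `[0, ∞]` no integrability has to be checked. -/
theorem lintegral_conv_sq_le {a b : Plane → ℝ≥0∞} (ha : Measurable a) (hb : Measurable b) :
    ∫⁻ z, (∫⁻ y, a (z - y) * b y) ^ 2 ≤ (∫⁻ z, a z) ^ 2 * ∫⁻ z, b z ^ 2 := by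
  calc ∫⁻ z, (∫⁻ y, a (z - y) * b y) ^ 2
      ≤ ∫⁻ z, (∫⁻ y, a y) * ∫⁻ y, a (z - y) * b y ^ 2 := by
        refine lintegral_mono fun z => ?_
        refine (sq_lintegral_mul_le (by fun_prop) (by fun_prop)).trans (le_of_eq ?_)
        rw [lintegral_sub_left_eq_self (fun y => a y) z]
    _ = (∫⁻ y, a y) * ∫⁻ z, ∫⁻ y, a (z - y) * b y ^ 2 := by
        rw [lintegral_const_mul]
        exact Measurable.lintegral_prod_right' (f := fun p : Plane × Plane => a (p.1 - p.2) * b p.2 ^ 2)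
          (by fun_prop)
    _ = (∫⁻ y, a y) * ∫⁻ y, ∫⁻ z, a (z - y) * b y ^ 2 := by
        rw [lintegral_lintegral_swap]
        exact Measurable.aemeasurable (by fun_prop)
    _ = _ := by
        rw [sq, mul_assoc]
        congr 1
        rw [← lintegral_const_mul _ (hb.pow_const 2)]
        refine lintegral_congr fun y => ?_
        rw [lintegral_mul_const _ (by fun_prop), lintegral_sub_right_eq_self (fun y => a y) y]

/-- The convolution `∫ k (z - y) f y dy`. -/
def conv (k f : Plane → ℂ) (z : Plane) : ℂ := ∫ y, k (z - y) * f y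

theorem measurable_conv {k f : Plane → ℂ} (hk : Measurable k) (hf : Measurable f) :
    Measurable (conv k f) := by
  have : StronglyMeasurable (fun p : Plane × Plane => k (p.1 - p.2) * f p.2) :=
    Measurable.stronglyMeasurable (by fun_prop)
  exact this.integral_prod_right'.measurable

theorem enorm_conv_le (k f : Plane → ℂ) (z : Plane) :
    ‖conv k f z‖ₑ ≤ ∫⁻ y, ‖k (z - y)‖ₑ * ‖f y‖ₑ := by
  refine (enorm_integral_le_lintegral_enorm _).trans (le_of_eq ?_)
  simp [enorm_mul]

theorem lintegral_enorm_conv_sq_le {k f : Plane → ℂ} (hk : Measurable k) (hf : Measurable f) :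
    ∫⁻ z, ‖conv k f z‖ₑ ^ 2 ≤ (∫⁻ z, ‖k z‖ₑ) ^ 2 * ∫⁻ z, ‖f z‖ₑ ^ 2 :=
  (lintegral_mono fun z => pow_le_pow_left' (enorm_conv_le k f z) 2).trans
    (lintegral_conv_sq_le hk.enorm hf.enorm)

theorem conv_comm (k f : Plane → ℂ) (z : Plane) : conv k f z = conv f k z := by
  unfold conv
  rw [← integral_sub_left_eq_self _ volume z]
  simp [mul_comm]

theorem memLp_two_iff {E : Type*} [NormedAddCommGroup E] {f : Plane → E}
    (hf : AEStronglyMeasurable f) :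
    MemLp f 2 ↔ ∫⁻ z, ‖f z‖ₑ ^ 2 < ⊤ := by
  rw [MemLp, and_iff_right hf, eLpNorm_lt_top_iff_lintegral_rpow_enorm_lt_top (by norm_num) (by norm_num)]
  simp

theorem enorm_sq_eq_lintegral {E : Type*} [NormedAddCommGroup E]
    (F : Lp E 2 (volume : Measure Plane)) :
    ‖F‖ₑ ^ 2 = ∫⁻ z, ‖F z‖ₑ ^ 2 := by
  rw [Lp.enorm_def, eLpNorm_eq_lintegral_rpow_enorm_toReal (by norm_num) (by norm_num)]
  simp only [ENNReal.toReal_ofNat, ENNReal.rpow_two]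
  rw [← ENNReal.rpow_natCast, ← ENNReal.rpow_mul]
  norm_num

theorem memLp_conv {k f : Plane → ℂ} (hk : Measurable k) (hf : Measurable f)
    (hki : Integrable k) (hfm : MemLp f 2) : MemLp (conv k f) 2 := by
  rw [memLp_two_iff (measurable_conv hk hf).aestronglyMeasurable]
  refine (lintegral_enorm_conv_sq_le hk hf).trans_lt (ENNReal.mul_lt_top ?_ ?_)
  · exact ENNReal.pow_lt_top hki.2
  · exact (memLp_two_iff hfm.1).1 hfm

end BO2

namespace BO2

/-! ### Fourier multipliers on `L²` -/

/-- The Fourier multiplier on `L²` with a bounded symbol. -/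
def mult (m : Plane → ℂ) (hm : MemLp m ⊤) (f : L2C) : L2C := 𝓕⁻ (hm.toLp m • 𝓕 f : L2C)

theorem fourier_mult_ae_eq (m : Plane → ℂ) (hm : MemLp m ⊤) (f : L2C) :
    ((𝓕 (mult m hm f) : L2C) : Plane → ℂ) =ᵐ[volume] fun ζ => m ζ * (𝓕 f : L2C) ζ := by
  rw [mult, FourierTransform.fourier_fourierInv_eq]
  filter_upwards [Lp.coeFn_lpSMul (r := 2) (hm.toLp m) (𝓕 f : L2C), hm.coeFn_toLp] with ζ h1 h2
  rw [h1, Pi.smul_apply', h2, smul_eq_mul]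

theorem enorm_mult_sq (m : Plane → ℂ) (hm : MemLp m ⊤) (f : L2C) :
    ‖mult m hm f‖ₑ ^ 2 = ∫⁻ ζ, ‖m ζ‖ₑ ^ 2 * ‖(𝓕 f : L2C) ζ‖ₑ ^ 2 := by
  rw [← ofReal_norm, ← Lp.norm_fourier_eq (mult m hm f), ofReal_norm,
    enorm_sq_eq_lintegral]
  refine lintegral_congr_ae ?_
  filter_upwards [fourier_mult_ae_eq m hm f] with ζ h
  rw [h, enorm_mul, mul_pow]

theorem mult_sub (m : Plane → ℂ) (hm : MemLp m ⊤) (f g : L2C) :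
    mult m hm (f - g) = mult m hm f - mult m hm g := by
  have h : (𝓕 (f - g) : L2C) = 𝓕 f - 𝓕 g := (Lp.fourierTransformₗᵢ Plane ℂ).map_sub f g
  have h' (f g : L2C) : (𝓕⁻ (f - g) : L2C) = 𝓕⁻ f - 𝓕⁻ g :=
    (Lp.fourierTransformₗᵢ Plane ℂ).symm.map_sub f g
  rw [mult, h, sub_eq_add_neg, Lp.add_smul, Lp.smul_neg, ← sub_eq_add_neg, h', mult, mult]

theorem norm_mult_le (m : Plane → ℂ) (hm : MemLp m ⊤) (f : L2C) :
    ‖mult m hm f‖ ≤ ‖hm.toLp m‖ * ‖f‖ := by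
  have h (g : L2C) : ‖(𝓕⁻ g : L2C)‖ = ‖g‖ := (Lp.fourierTransformₗᵢ Plane ℂ).symm.norm_map g
  rw [mult, h, ← Lp.norm_fourier_eq f]
  exact Lp.norm_smul_le _ _

theorem continuous_mult (m : Plane → ℂ) (hm : MemLp m ⊤) : Continuous (mult m hm) := by
  refine (LipschitzWith.of_dist_le_mul (K := ‖hm.toLp m‖₊) fun f g => ?_).continuous
  rw [dist_eq_norm, ← mult_sub, dist_eq_norm]
  exact norm_mult_le m hm _

/-- The Schwartz function `y ↦ ψ (z - y)`. -/
def reflect (z : Plane) (ψ : 𝓢(Plane, ℂ)) : 𝓢(Plane, ℂ) :=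
  SchwartzMap.compSubConstCLM ℝ z
    (SchwartzMap.compCLMOfContinuousLinearEquiv ℝ (ContinuousLinearEquiv.neg ℝ) ψ)

theorem reflect_apply (z : Plane) (ψ : 𝓢(Plane, ℂ)) (y : Plane) : reflect z ψ y = ψ (z - y) := by
  simp [reflect]

theorem fourierInv_reflect (z : Plane) (m : 𝓢(Plane, ℂ)) (ζ : Plane) :
    (𝓕⁻ (reflect z (𝓕⁻ m))) ζ = Real.fourierChar (inner ℝ ζ z) • m ζ := by
  have h : (𝓕 (𝓕⁻ m)) ζ = m ζ := by rw [FourierTransform.fourier_fourierInv_eq]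
  rw [← h, SchwartzMap.fourierInv_coe, SchwartzMap.fourier_coe, Real.fourierInv_eq, Real.fourier_eq,
    ← integral_sub_left_eq_self _ volume z, Circle.smul_def, ← integral_smul]
  refine integral_congr_ae (.of_forall fun y => ?_)
  simp only [reflect_apply, sub_sub_cancel, ← Circle.smul_def, inner_sub_left, smul_smul,
    ← AddChar.map_add_eq_mul, real_inner_comm z ζ, ← sub_eq_add_neg]

theorem integrable_schwartz_mul (m : 𝓢(Plane, ℂ)) (f : L2C) :
    Integrable fun ζ => m ζ * f ζ :=
  (m.memLp 2).integrable_mul (Lp.memLp f)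

/-- The convolution at `z` is the pairing of `f` with the reflected kernel, whose inverse transform
is a character times `m`. The identity holds at every point, so the convolution is the continuous
representative of the multiplier. -/
theorem conv_fourierInv_eq (m : 𝓢(Plane, ℂ)) (f : L2C) (z : Plane) :
    conv (𝓕⁻ m : 𝓢(Plane, ℂ)) f z = 𝓕⁻ (fun ζ => m ζ * (𝓕 f : L2C) ζ) z := by
  have h := integral_fourier_mul_schwartz f (𝓕⁻ (reflect z (𝓕⁻ m)))
  rw [FourierTransform.fourier_fourierInv_eq] at h
  rw [Real.fourierInv_eq, conv]
  calc _ = ∫ y, f y * reflect z (𝓕⁻ m) y := by simp_rw [reflect_apply, mul_comm]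
    _ = _ := h.symm
    _ = _ := by
      refine integral_congr_ae (.of_forall fun ζ => ?_)
      simp only [fourierInv_reflect, Circle.smul_def, smul_eq_mul]
      ring

theorem mult_ae_eq_fourierInv (m : 𝓢(Plane, ℂ)) (hm : MemLp m ⊤) (f : L2C) :
    (mult m hm f : Plane → ℂ) =ᵐ[volume] 𝓕⁻ (fun ζ => m ζ * (𝓕 f : L2C) ζ) := by
  have e : ((hm.toLp m • 𝓕 f : L2C) : Plane → ℂ) =ᵐ[volume] fun ζ => m ζ * (𝓕 f : L2C) ζ := by
    filter_upwards [Lp.coeFn_lpSMul (r := 2) (hm.toLp m) (𝓕 f : L2C), hm.coeFn_toLp] with ζ h1 h2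
    rw [h1, Pi.smul_apply', h2, smul_eq_mul]
  have h := fourierInv_toLp_ae_eq _ ((integrable_schwartz_mul m (𝓕 f)).congr e.symm)
  refine h.trans (.of_forall fun z => ?_)
  exact Real.fourierInv_congr_ae e z

theorem mult_ae_eq_conv (m : 𝓢(Plane, ℂ)) (hm : MemLp m ⊤) (f : L2C) :
    (mult m hm f : Plane → ℂ) =ᵐ[volume] conv (𝓕⁻ m : 𝓢(Plane, ℂ)) f := by
  refine (mult_ae_eq_fourierInv m hm f).trans (.of_forall fun z => ?_)
  exact (conv_fourierInv_eq m f z).symm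

theorem integral_reflect_mul (m θ : 𝓢(Plane, ℂ)) {Φ : 𝓢(Plane, ℂ)}
    (hΦ : ∀ ζ, Φ ζ = m ζ * (𝓕⁻ θ) ζ) (y : Plane) :
    (𝓕 Φ) y = ∫ z, (𝓕⁻ m) (z - y) * θ z := by
  have h := SchwartzMap.integral_fourier_mul_eq
    (SchwartzMap.compSubConstCLM ℝ y (𝓕⁻ m : 𝓢(Plane, ℂ))) (𝓕⁻ θ)
  rw [FourierTransform.fourier_fourierInv_eq] at h
  simp only [SchwartzMap.compSubConstCLM_apply] at h
  rw [← h, SchwartzMap.fourier_coe, Real.fourier_eq]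
  refine integral_congr_ae (.of_forall fun ζ => ?_)
  have h2 : (𝓕 (SchwartzMap.compSubConstCLM ℝ y (𝓕⁻ m : 𝓢(Plane, ℂ)))) ζ =
      Real.fourierChar (-inner ℝ ζ y) • m ζ := by
    have h : (𝓕 (𝓕⁻ m)) ζ = m ζ := by rw [FourierTransform.fourier_fourierInv_eq]
    rw [← h, SchwartzMap.fourier_coe, SchwartzMap.fourier_coe, Real.fourier_eq, Real.fourier_eq,
      ← integral_add_right_eq_self _ y, Circle.smul_def, ← integral_smul]
    refine integral_congr_ae (.of_forall fun z => ?_)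
    simp only [SchwartzMap.compSubConstCLM_apply, add_sub_cancel_right, ← Circle.smul_def,
      inner_add_left, smul_smul, ← AddChar.map_add_eq_mul, real_inner_comm ζ y, neg_add]
    rw [add_comm]
  simp only [h2, hΦ, Circle.smul_def, smul_eq_mul]
  ring

end BO2

namespace BO2

/-! ### Disjoint frequencies -/

theorem norm_fourierInv_le (G : Plane → ℂ) (z : Plane) : ‖(𝓕⁻ G) z‖ ≤ ∫ ζ, ‖G ζ‖ := by
  rw [Real.fourierInv_eq]
  refine (norm_integral_le_integral_norm _).trans (le_of_eq ?_)
  simp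

/-- Moving the inverse transform onto the kernel leaves an integral of `G ζ * m ζ` times a
character, which vanishes identically. -/
theorem conv_fourierInv_eq_zero (m : 𝓢(Plane, ℂ)) {G : Plane → ℂ} (hG : Integrable G)
    (h : ∀ ζ, G ζ ≠ 0 → m ζ = 0) (z : Plane) : conv (𝓕⁻ m : 𝓢(Plane, ℂ)) (𝓕⁻ G) z = 0 := by
  have e := integral_fourierInv_mul hG (reflect z (𝓕⁻ m)).integrable
  have : conv (𝓕⁻ m : 𝓢(Plane, ℂ)) (𝓕⁻ G) z = ∫ y, (𝓕⁻ G) y * reflect z (𝓕⁻ m) y := by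
    simp_rw [conv, reflect_apply, mul_comm]
  rw [this, e, ← SchwartzMap.fourierInv_coe]
  refine integral_eq_zero_of_ae (.of_forall fun ζ => ?_)
  by_cases hζ : G ζ = 0
  · simp [hζ]
  · simp [fourierInv_reflect, h ζ hζ]

/-- The two factors of the square are unfolded one after the other: the first use of duality
produces a character at `ζ`, and the second turns it into a shift of frequency, so that only values
`G ζ * G ζ' * m (ζ + ζ')` occur. This replaces the convolution theorem. -/
theorem conv_fourierInv_sq_eq_zero (m : 𝓢(Plane, ℂ)) {G : Plane → ℂ} (hG : Integrable G)
    (h : ∀ ζ ζ', G ζ ≠ 0 → G ζ' ≠ 0 → m (ζ + ζ') = 0) (z : Plane) :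
    conv (𝓕⁻ m : 𝓢(Plane, ℂ)) (fun y => (𝓕⁻ G) y ^ 2) z = 0 := by
  set ψ := reflect z (𝓕⁻ m) with hψ
  have hi (c : Plane → ℂ) (hc : Continuous c) (hc1 : ∀ y, ‖c y‖ ≤ 1) :
      Integrable fun y => c y * ψ y :=
    ψ.integrable.bdd_mul (c := 1) hc.aestronglyMeasurable (.of_forall hc1)
  have hψG : Integrable fun y => (𝓕⁻ G) y * ψ y :=
    ψ.integrable.bdd_mul (c := ∫ ζ, ‖G ζ‖) (continuous_fourierInv hG).aestronglyMeasurable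
      (.of_forall (norm_fourierInv_le G))
  have e := integral_fourierInv_mul hG hψG
  have : conv (𝓕⁻ m : 𝓢(Plane, ℂ)) (fun y => (𝓕⁻ G) y ^ 2) z =
      ∫ y, (𝓕⁻ G) y * ((𝓕⁻ G) y * ψ y) := by
    simp_rw [conv, hψ, reflect_apply]
    congr 1 with y
    ring
  rw [this, e]
  refine integral_eq_zero_of_ae (.of_forall fun ζ => ?_)
  by_cases hζ : G ζ = 0
  · simp [hζ]
  suffices hs : (𝓕⁻ fun y => (𝓕⁻ G) y * ψ y) ζ = 0 by simp [hs]
  have hc : Continuous fun y : Plane => (Real.fourierChar (inner ℝ y ζ) : ℂ) :=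
    continuous_subtype_val.comp (Real.continuous_fourierChar.comp (by fun_prop))
  have e2 := integral_fourierInv_mul hG (hi _ hc fun y => (Circle.norm_coe _).le)
  rw [Real.fourierInv_eq]
  calc _ = ∫ y, (𝓕⁻ G) y * (Real.fourierChar (inner ℝ y ζ) * ψ y) := by
        refine integral_congr_ae (.of_forall fun y => ?_)
        simp only [Circle.smul_def, smul_eq_mul]
        ring
    _ = _ := e2
    _ = 0 := by
      refine integral_eq_zero_of_ae (.of_forall fun ζ' => ?_)
      by_cases hζ' : G ζ' = 0
      · simp [hζ']
      -- Modulation by a character translates the transform.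
      have e3 : (𝓕⁻ fun y => (Real.fourierChar (inner ℝ y ζ) : ℂ) * ψ y) ζ' =
          (𝓕⁻ ψ) (ζ + ζ') := by
        rw [SchwartzMap.fourierInv_coe, Real.fourierInv_eq, Real.fourierInv_eq]
        refine integral_congr_ae (.of_forall fun y => ?_)
        simp only [← Circle.smul_def, inner_add_right, AddChar.map_add_eq_mul,
          ← smul_eq_mul]
        rw [smul_comm, smul_assoc]
      change G ζ' * _ = 0
      rw [e3, hψ, fourierInv_reflect, h ζ ζ' hζ hζ', smul_zero, mul_zero]

/-! ### Dilations of symbols -/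

theorem fourierInv_dilate {m m' : 𝓢(Plane, ℂ)} {a : ℂ} {c : ℝ} (hc : 0 < c)
    (h : ∀ ζ, m' ζ = a * m (c⁻¹ • ζ)) (z : Plane) :
    (𝓕⁻ m') z = a * (c : ℂ) ^ 2 * (𝓕⁻ m) (c • z) := by
  rw [SchwartzMap.fourierInv_coe, SchwartzMap.fourierInv_coe, Real.fourierInv_eq,
    Real.fourierInv_eq]
  have e := Measure.integral_comp_smul (volume : Measure Plane)
    (fun ζ => Real.fourierChar (inner ℝ ζ (c • z)) • m ζ) c⁻¹
  have hd : Module.finrank ℝ Plane = 2 := by simp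
  rw [hd, inv_pow, inv_inv, abs_of_pos (by positivity)] at e
  rw [mul_assoc, ← Complex.ofReal_pow, ← Complex.real_smul, ← e, ← integral_const_mul]
  refine integral_congr_ae (.of_forall fun ζ => ?_)
  simp only [h, inner_smul_left, inner_smul_right, Circle.smul_def, smul_eq_mul]
  rw [show c * ((starRingEnd ℝ) c⁻¹ * inner ℝ ζ z) = inner ℝ ζ z by
    rw [RCLike.conj_to_real, mul_inv_cancel_left₀ hc.ne']]
  ring

theorem integral_comp_dilate (F : Plane → ℝ) {c : ℝ} (hc : 0 < c) :
    ∫ z, c ^ 2 * F (c • z) = ∫ z, F z := by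
  rw [integral_const_mul, Measure.integral_comp_smul]
  have hd : Module.finrank ℝ Plane = 2 := by simp
  rw [hd, abs_of_pos (by positivity), smul_eq_mul]
  field_simp

/-- The symbol `2πi ξ m` of `∂ₓ` composed with the multiplier with symbol `m`. -/
def dx (m : 𝓢(Plane, ℂ)) : 𝓢(Plane, ℂ) :=
  (2 * Real.pi * Complex.I) • SchwartzMap.smulLeftCLM ℂ (inner ℝ · (e 0)) m

theorem dx_apply (m : 𝓢(Plane, ℂ)) (ζ : Plane) :
    dx m ζ = 2 * Real.pi * Complex.I * (ζ 0 * m ζ) := by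
  have : (inner ℝ · (e 0) : Plane → ℝ).HasTemperateGrowth := by fun_prop
  rw [dx, smul_apply, SchwartzMap.smulLeftCLM_apply_apply this]
  simp [e, EuclideanSpace.inner_single_right]

/-- `‖K‖_{L¹}` for the kernel `K` of the multiplier with symbol `m`. -/
def kernelNorm (m : 𝓢(Plane, ℂ)) : ℝ := ∫ z, ‖(𝓕⁻ m) z‖

/-- `‖|z| ∂ₓ K‖_{L¹}` for the kernel `K` of the multiplier with symbol `m`. -/
def kernelMoment (m : 𝓢(Plane, ℂ)) : ℝ := ∫ z, ‖z‖ * ‖(𝓕⁻ (dx m)) z‖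

theorem kernelNorm_dilate {m m' : 𝓢(Plane, ℂ)} {c : ℝ} (hc : 0 < c)
    (h : ∀ ζ, m' ζ = m (c⁻¹ • ζ)) : kernelNorm m' = kernelNorm m := by
  rw [kernelNorm, kernelNorm, ← integral_comp_dilate (fun z => ‖(𝓕⁻ m : 𝓢(Plane, ℂ)) z‖) hc]
  refine integral_congr_ae (.of_forall fun z => ?_)
  simp only [fourierInv_dilate (a := 1) hc (fun ζ => by rw [one_mul, h ζ]) z]
  simp

/-- The factor `c` gained from `∂ₓ` cancels the one lost from the weight `‖z‖`. This scale
invariance makes the commutator bound uniform in `λ`. -/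
theorem kernelMoment_dilate {m m' : 𝓢(Plane, ℂ)} {c : ℝ} (hc : 0 < c)
    (h : ∀ ζ, m' ζ = m (c⁻¹ • ζ)) : kernelMoment m' = kernelMoment m := by
  rw [kernelMoment, kernelMoment,
    ← integral_comp_dilate (fun z => ‖z‖ * ‖(𝓕⁻ (dx m) : 𝓢(Plane, ℂ)) z‖) hc]
  refine integral_congr_ae (.of_forall fun z => ?_)
  have h' (ζ : Plane) : dx m' ζ = c * dx m (c⁻¹ • ζ) := by
    have : (c : ℂ) ≠ 0 := by exact_mod_cast hc.ne'
    simp only [dx_apply, h, PiLp.smul_apply, smul_eq_mul, Complex.ofReal_mul, Complex.ofReal_inv]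
    field_simp
  simp only [fourierInv_dilate hc h' z]
  simp [norm_smul, abs_of_pos hc]
  ring

theorem lintegral_enorm_fourierInv (m : 𝓢(Plane, ℂ)) :
    ∫⁻ z, ‖(𝓕⁻ m) z‖ₑ = ENNReal.ofReal (kernelNorm m) := by
  rw [kernelNorm, ofReal_integral_norm_eq_lintegral_enorm (𝓕⁻ m).integrable]

theorem integrable_kernelMoment (m : 𝓢(Plane, ℂ)) :
    Integrable fun z => ‖z‖ * ‖(𝓕⁻ (dx m)) z‖ := by
  simpa only [pow_one] using (𝓕⁻ (dx m) : 𝓢(Plane, ℂ)).integrable_pow_mul volume 1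

theorem lintegral_enorm_kernelMoment (m : 𝓢(Plane, ℂ)) :
    ∫⁻ z, ‖z‖ₑ * ‖(𝓕⁻ (dx m)) z‖ₑ = ENNReal.ofReal (kernelMoment m) := by
  have h := ofReal_integral_norm_eq_lintegral_enorm (integrable_kernelMoment m)
  rw [kernelMoment]
  simpa [enorm_mul] using h.symm

end BO2

namespace BO2

/-! ### Dyadic symbols -/

namespace DyadicPartition

variable (P : DyadicPartition)

theorem contDiff_symbol (j : ℕ) : ContDiff ℝ ∞ (P.symbol j) := by
  unfold symbol
  split_ifs
  · exact P.contDiff_χ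
  · exact P.contDiff_φ.comp (contDiff_const_smul _)

theorem norm_lt_of_symbol_ne_zero {j : ℕ} {ζ : Plane} (h : P.symbol j ζ ≠ 0) :
    ‖ζ‖ < 2 ^ (j + 1) := by
  unfold symbol at h
  split_ifs at h with hj
  · have := P.tsupport_χ (subset_tsupport _ h)
    simpa [hj] using this
  · have := (P.tsupport_φ (subset_tsupport _ h)).2
    rw [norm_smul, norm_inv, norm_pow, Real.norm_ofNat, inv_mul_lt_iff₀ (by positivity)] at this
    rwa [pow_succ]

theorem lt_norm_of_symbol_ne_zero {j : ℕ} {ζ : Plane} (h : P.symbol (j + 1) ζ ≠ 0) :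
    2 ^ j < ‖ζ‖ := by
  have := (P.tsupport_φ (subset_tsupport _ (by simpa [symbol] using h))).1
  rw [norm_smul, norm_inv, norm_pow, Real.norm_ofNat, lt_inv_mul_iff₀ (by positivity)] at this
  rw [pow_succ] at this
  linarith

theorem hasCompactSupport_symbol (j : ℕ) : HasCompactSupport (P.symbol j) := by
  refine HasCompactSupport.of_support_subset_isCompact
    (isCompact_closedBall (0 : Plane) (2 ^ (j + 1))) fun ζ hζ => ?_
  simpa using (P.norm_lt_of_symbol_ne_zero hζ).le

end DyadicPartition

/-- A smooth compactly supported symbol of the angular frequency, as a Schwartz function of the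
frequency. -/
def schwartzSymbol (g : Plane → ℝ) (hg : ContDiff ℝ ∞ g) (hc : HasCompactSupport g) :
    𝓢(Plane, ℂ) :=
  HasCompactSupport.toSchwartzMap (f := fun ζ => ((g ((2 * Real.pi) • ζ) : ℝ) : ℂ))
    ((hc.comp_smul Real.two_pi_pos.ne').comp_left (g := ((↑) : ℝ → ℂ)) (by simp))
    (Complex.ofRealCLM.contDiff.comp (hg.comp (contDiff_const_smul _)))

namespace DyadicPartition

variable (P : DyadicPartition)

/-- The symbol of `Δ_λ`, `λ = 2 ^ j`, as a Schwartz function. -/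
def blockSymbol (j : ℕ) : 𝓢(Plane, ℂ) :=
  schwartzSymbol (P.symbol j) (P.contDiff_symbol j) (P.hasCompactSupport_symbol j)

theorem blockSymbol_apply (j : ℕ) (ζ : Plane) :
    P.blockSymbol j ζ = P.symbol j ((2 * Real.pi) • ζ) := rfl

theorem memLp_blockSymbol (j : ℕ) : MemLp (P.blockSymbol j) ⊤ := P.memLp_symbol j

theorem block_eq_mult (j : ℕ) (f : L2C) :
    P.block j f = mult (P.blockSymbol j) (P.memLp_blockSymbol j) f := rfl

/-- All blocks with `j ≥ 1` are dilates of the block `j = 1`, so two symbols determine all the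
values. -/
theorem exists_kernel_bound : ∃ M : ℝ, 0 ≤ M ∧
    ∀ j, kernelNorm (P.blockSymbol j) ≤ M ∧ kernelMoment (P.blockSymbol j) ≤ M := by
  have h0 (m) : 0 ≤ kernelNorm m := integral_nonneg fun z => norm_nonneg _
  have h1 (m) : 0 ≤ kernelMoment m := integral_nonneg fun z => by positivity
  refine ⟨kernelNorm (P.blockSymbol 0) + kernelMoment (P.blockSymbol 0) +
    (kernelNorm (P.blockSymbol 1) + kernelMoment (P.blockSymbol 1)), ?_, fun j => ?_⟩
  · have := h0 (P.blockSymbol 0); have := h1 (P.blockSymbol 0)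
    have := h0 (P.blockSymbol 1); have := h1 (P.blockSymbol 1)
    positivity
  have := h0 (P.blockSymbol 0); have := h1 (P.blockSymbol 0)
  have := h0 (P.blockSymbol 1); have := h1 (P.blockSymbol 1)
  rcases j with _ | j
  · constructor <;> linarith
  have h (ζ : Plane) : P.blockSymbol (j + 1) ζ = P.blockSymbol 1 (((2 : ℝ) ^ j)⁻¹ • ζ) := by
    simp only [blockSymbol_apply, symbol, smul_smul, Nat.succ_ne_zero, if_false]
    congr 3
    simp only [pow_succ, pow_zero, one_mul, mul_inv]
    ring
  rw [kernelNorm_dilate (by positivity) h, kernelMoment_dilate (by positivity) h]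
  constructor <;> linarith

/-- For the least `n` with `‖ζ‖ < 2 ^ (n + 1)`, the support conditions exclude every index other
than `n` and `n + 1` from the partition of unity at `ζ`. -/
theorem exists_symbol_add_eq_one (ζ : Plane) :
    ∃ n, P.symbol n ζ + P.symbol (n + 1) ζ = 1 ∧ ‖ζ‖ < 2 ^ (n + 1) := by
  obtain ⟨n, hn, hn'⟩ : ∃ n : ℕ, ‖ζ‖ < 2 ^ (n + 1) ∧ (n = 0 ∨ 2 ^ n ≤ ‖ζ‖) := by
    have hex : ∃ n : ℕ, ‖ζ‖ < 2 ^ (n + 1) := by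
      obtain ⟨n, hn⟩ := pow_unbounded_of_one_lt ‖ζ‖ (one_lt_two)
      exact ⟨n, hn.trans (pow_lt_pow_right₀ one_lt_two n.lt_succ_self)⟩
    classical
    refine ⟨Nat.find hex, Nat.find_spec hex, ?_⟩
    rcases h : Nat.find hex with _ | m
    · exact .inl rfl
    · exact .inr (not_lt.1 (Nat.find_min hex (m := m) (by omega)))
  refine ⟨n, ?_, hn⟩
  have hz (i : ℕ) (h1 : i ≠ n) (h2 : i ≠ n + 1) : P.symbol i ζ = 0 := by
    by_contra h
    rcases lt_or_gt_of_ne h1 with hi | hi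
    · have h3 := P.norm_lt_of_symbol_ne_zero h
      have h4 : (2 : ℝ) ^ (i + 1) ≤ 2 ^ n := pow_le_pow_right₀ one_le_two hi
      rcases hn' with rfl | hn'
      · omega
      · linarith
    · obtain ⟨i, rfl⟩ : ∃ k, i = k + 1 := ⟨i - 1, by omega⟩
      have h3 := P.lt_norm_of_symbol_ne_zero h
      have h4 : (2 : ℝ) ^ (n + 1) ≤ 2 ^ i := pow_le_pow_right₀ one_le_two (by omega)
      linarith
  have hs : HasSum (fun i => P.symbol i ζ) 1 := by
    have h := P.hasSum_one ζ
    rw [← hasSum_nat_add_iff' 1]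
    simpa [symbol] using h
  have hs' : HasSum (fun i => P.symbol i ζ) _ := hasSum_sum_of_ne_finset_zero (s := {n, n + 1})
    (fun i hi => by
      simp only [Finset.mem_insert, Finset.mem_singleton, not_or] at hi
      exact hz i hi.1 hi.2)
  rw [Finset.sum_pair (by omega)] at hs'
  exact hs'.unique hs

/-- Two real numbers with sum `1` satisfy `2 (a² + b²) ≥ 1`, and the lower bound on `‖ζ‖` forces
both active indices to be at least `r`. -/
theorem one_le_tsum_symbol_sq {r : ℕ} {ζ : Plane} (h : r = 0 ∨ 2 ^ r ≤ ‖ζ‖) :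
    1 ≤ 2 * ∑' i, if r ≤ i then ‖(P.symbol i ζ : ℂ)‖ₑ ^ 2 else 0 := by
  obtain ⟨n, hn, hn'⟩ := P.exists_symbol_add_eq_one ζ
  have hr : r ≤ n := by
    rcases h with rfl | h
    · exact Nat.zero_le n
    · have := (pow_lt_pow_iff_right₀ (one_lt_two (α := ℝ))).1 (h.trans_lt hn')
      omega
  have h1 : (1 : ℝ) ≤ 2 * (P.symbol n ζ ^ 2 + P.symbol (n + 1) ζ ^ 2) := by
    nlinarith [sq_nonneg (P.symbol n ζ - P.symbol (n + 1) ζ)]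
  have e (a : ℝ) : ‖(a : ℂ)‖ₑ ^ 2 = ENNReal.ofReal (a ^ 2) := by
    rw [← ofReal_norm, ← ENNReal.ofReal_pow (norm_nonneg _)]
    simp
  calc (1 : ℝ≥0∞) = ENNReal.ofReal 1 := by simp
    _ ≤ _ := ENNReal.ofReal_le_ofReal h1
    _ = 2 * ∑ i ∈ {n, n + 1}, (if r ≤ i then ‖(P.symbol i ζ : ℂ)‖ₑ ^ 2 else 0) := by
      rw [Finset.sum_pair (by omega), if_pos hr, if_pos (by omega), e, e,
        ENNReal.ofReal_mul (by norm_num), ENNReal.ofReal_add (by positivity) (by positivity)]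
      simp
    _ ≤ _ := by gcongr; exact ENNReal.sum_le_tsum _

/-- Almost orthogonality: Plancherel, with the pointwise lower bound for the sum of the squared
symbols inserted under the integral. -/
theorem enorm_sq_le_tsum_block {f h : L2C} (r : ℕ)
    (hfh : ∀ᵐ ζ, ‖(𝓕 h : L2C) ζ‖ₑ ≤ ‖(𝓕 f : L2C) ζ‖ₑ ∧
      ((𝓕 h : L2C) ζ ≠ 0 → r = 0 ∨ 2 ^ r ≤ ‖(2 * Real.pi) • ζ‖)) :
    ‖h‖ₑ ^ 2 ≤ 2 * ∑' i, if r ≤ i then ‖P.block i f‖ₑ ^ 2 else 0 := by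
  have hm (i : ℕ) : Measurable fun ζ : Plane => ‖P.blockSymbol i ζ‖ₑ ^ 2 * ‖(𝓕 f : L2C) ζ‖ₑ ^ 2 :=
    ((P.blockSymbol i).continuous.measurable.enorm.pow_const 2).mul
      ((Lp.stronglyMeasurable _).measurable.enorm.pow_const 2)
  calc ‖h‖ₑ ^ 2 = ∫⁻ ζ, ‖(𝓕 h : L2C) ζ‖ₑ ^ 2 := by
        rw [← ofReal_norm, ← Lp.norm_fourier_eq h, ofReal_norm, enorm_sq_eq_lintegral]
    _ ≤ ∫⁻ ζ, 2 * ∑' i, if r ≤ i then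
          ‖P.blockSymbol i ζ‖ₑ ^ 2 * ‖(𝓕 f : L2C) ζ‖ₑ ^ 2 else 0 := by
        refine lintegral_mono_ae ?_
        filter_upwards [hfh] with ζ hζ
        by_cases h0 : (𝓕 h : L2C) ζ = 0
        · simp [h0]
        calc _ ≤ 1 * ‖(𝓕 f : L2C) ζ‖ₑ ^ 2 := by rw [one_mul]; exact pow_le_pow_left' hζ.1 2
          _ ≤ _ := mul_le_mul_left (P.one_le_tsum_symbol_sq (hζ.2 h0)) _
          _ = _ := by
            rw [mul_assoc, ← ENNReal.tsum_mul_right]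
            simp only [ite_mul, zero_mul, blockSymbol_apply]
    _ = _ := by
        rw [lintegral_const_mul' _ _ (by simp), lintegral_tsum]
        · congr 2 with i
          split_ifs
          · rw [block_eq_mult, enorm_mult_sq]
          · simp
        · intro i
          split_ifs
          · exact (hm i).aemeasurable
          · exact aemeasurable_const

end DyadicPartition

/-! ### Low-frequency cut-offs -/

/-- A smooth bump which is `1` on the unit ball and supported in the ball of radius `2`. -/
def lowBump : ContDiffBump (0 : Plane) := ⟨1, 2, one_pos, one_lt_two⟩

/-- The symbol of the projection to the angular frequencies below `2 ^ r`. -/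
def lowSymbol (r : ℕ) : 𝓢(Plane, ℂ) :=
  schwartzSymbol (fun ζ => lowBump (((2 : ℝ) ^ r)⁻¹ • ζ))
    (lowBump.contDiff.comp (contDiff_const_smul _))
    (lowBump.hasCompactSupport.comp_smul (by positivity))

theorem lowSymbol_apply (r : ℕ) (ζ : Plane) :
    lowSymbol r ζ = lowBump (((2 : ℝ) ^ r)⁻¹ • (2 * Real.pi) • ζ) := rfl

theorem norm_lt_of_lowSymbol_ne_zero {r : ℕ} {ζ : Plane} (h : lowSymbol r ζ ≠ 0) :
    ‖(2 * Real.pi) • ζ‖ < 2 ^ (r + 1) := by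
  by_contra! h'
  refine h ?_
  rw [lowSymbol_apply, lowBump.zero_of_le_dist, Complex.ofReal_zero]
  rw [dist_zero_right, norm_smul, norm_inv, norm_pow, Real.norm_ofNat,
    le_inv_mul_iff₀ (by positivity)]
  simpa [lowBump, pow_succ] using h'

theorem le_norm_of_lowSymbol_ne_one {r : ℕ} {ζ : Plane} (h : 1 - lowSymbol r ζ ≠ 0) :
    2 ^ r ≤ ‖(2 * Real.pi) • ζ‖ := by
  by_contra! h'
  refine h ?_
  rw [lowSymbol_apply, lowBump.one_of_mem_closedBall, Complex.ofReal_one, sub_self]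
  rw [mem_closedBall_zero_iff, norm_smul, norm_inv, norm_pow, Real.norm_ofNat,
    inv_mul_le_iff₀ (by positivity)]
  simpa [lowBump] using h'.le

theorem norm_one_sub_lowSymbol_le (r : ℕ) (ζ : Plane) : ‖1 - lowSymbol r ζ‖ ≤ 1 := by
  rw [lowSymbol_apply, ← Complex.ofReal_one, ← Complex.ofReal_sub, Complex.norm_real,
    Real.norm_eq_abs, abs_le]
  have := lowBump.nonneg (x := ((2 : ℝ) ^ r)⁻¹ • (2 * Real.pi) • ζ)
  have := lowBump.le_one (x := ((2 : ℝ) ^ r)⁻¹ • (2 * Real.pi) • ζ)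
  constructor <;> linarith

theorem kernelNorm_lowSymbol (r : ℕ) : kernelNorm (lowSymbol r) = kernelNorm (lowSymbol 0) := by
  refine kernelNorm_dilate (c := 2 ^ r) (by positivity) fun ζ => ?_
  simp only [lowSymbol_apply, pow_zero, inv_one, one_smul]
  rw [smul_comm]

/-- The bump is real and even, so its kernel is real. Hence the low-frequency part of a real
function is real, which the integration by parts uses. -/
theorem conj_kernel_lowSymbol (r : ℕ) (z : Plane) :
    (starRingEnd ℂ) ((𝓕⁻ (lowSymbol r)) z) = (𝓕⁻ (lowSymbol r)) z := by
  rw [SchwartzMap.fourierInv_coe, Real.fourierInv_eq, ← integral_conj, ← integral_neg_eq_self]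
  refine integral_congr_ae (.of_forall fun ζ => ?_)
  have : lowBump (((2 : ℝ) ^ r)⁻¹ • (2 * Real.pi) • -ζ) =
      lowBump (((2 : ℝ) ^ r)⁻¹ • (2 * Real.pi) • ζ) := by
    rw [smul_neg, smul_neg, lowBump.neg]
  simp only [lowSymbol_apply, this, Circle.smul_def, smul_eq_mul, map_mul, Complex.conj_ofReal,
    inner_neg_left]
  rw [AddChar.map_neg_eq_inv, Circle.coe_inv_eq_conj, Complex.conj_conj]

theorem DyadicPartition.blockSymbol_eq_zero_of_low (P : DyadicPartition) {r j : ℕ} (h : r + 3 ≤ j)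
    {ζ : Plane} (hζ : lowSymbol r ζ ≠ 0) : P.blockSymbol j ζ = 0 := by
  by_contra h0
  obtain ⟨j, rfl⟩ : ∃ i, j = i + 1 := ⟨j - 1, by omega⟩
  have h1 := P.lt_norm_of_symbol_ne_zero (j := j) (ζ := (2 * Real.pi) • ζ)
    fun h => h0 (by rw [blockSymbol_apply, h, Complex.ofReal_zero])
  have h2 := norm_lt_of_lowSymbol_ne_zero hζ
  have h4 : (2 : ℝ) ^ (r + 1) ≤ 2 ^ j := pow_le_pow_right₀ one_le_two (by omega)
  linarith

/-- The gap `3` is chosen for products: two frequencies below `2 ^ (r + 1)` add up to one below `2 ^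
(r + 2)`, and the block `j` lives above `2 ^ (j - 1)`. -/
theorem DyadicPartition.blockSymbol_add_eq_zero_of_low (P : DyadicPartition) {r j : ℕ}
    (h : r + 3 ≤ j) {ζ ζ' : Plane} (hζ : lowSymbol r ζ ≠ 0) (hζ' : lowSymbol r ζ' ≠ 0) :
    P.blockSymbol j (ζ + ζ') = 0 := by
  by_contra h0
  obtain ⟨j, rfl⟩ : ∃ i, j = i + 1 := ⟨j - 1, by omega⟩
  have h1 := P.lt_norm_of_symbol_ne_zero (j := j) (ζ := (2 * Real.pi) • (ζ + ζ'))
    fun h => h0 (by rw [blockSymbol_apply, h, Complex.ofReal_zero])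
  have h2 := norm_lt_of_lowSymbol_ne_zero hζ
  have h3 := norm_lt_of_lowSymbol_ne_zero hζ'
  have h4 : (2 : ℝ) ^ (r + 1 + 1) ≤ 2 ^ j := pow_le_pow_right₀ one_le_two (by omega)
  rw [smul_add] at h1
  have h5 := norm_add_le ((2 * Real.pi) • ζ) ((2 * Real.pi) • ζ')
  rw [pow_succ] at h4
  linarith

end BO2

namespace BO2

/-! ### The trilinear estimate -/

theorem conv_congr_ae {k f g : Plane → ℂ} (h : f =ᵐ[volume] g) : conv k f = conv k g := by
  ext z
  refine integral_congr_ae ?_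
  filter_upwards [h] with y hy
  rw [hy]

theorem continuous_conv_fourierInv (m : 𝓢(Plane, ℂ)) (f : L2C) :
    Continuous (conv (𝓕⁻ m : 𝓢(Plane, ℂ)) f) := by
  have : conv (𝓕⁻ m : 𝓢(Plane, ℂ)) f = 𝓕⁻ (fun ζ => m ζ * (𝓕 f : L2C) ζ) :=
    funext (conv_fourierInv_eq m f)
  rw [this]
  exact continuous_fourierInv (integrable_schwartz_mul m _)

/-- Differentiation under the integral in the Fourier inversion formula. The integrand has constant
modulus along the line, so `‖dx m ζ * 𝓕 f ζ‖` is an integrable majorant of the derivative. -/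
theorem hasLineDerivAt_conv (m : 𝓢(Plane, ℂ)) (f : L2C) (z : Plane) :
    HasLineDerivAt ℝ (conv (𝓕⁻ m : 𝓢(Plane, ℂ)) f)
      (conv (𝓕⁻ (dx m) : 𝓢(Plane, ℂ)) f z) z (e 0) := by
  have h0 : conv (𝓕⁻ m : 𝓢(Plane, ℂ)) f = 𝓕⁻ (fun ζ => m ζ * (𝓕 f : L2C) ζ) :=
    funext (conv_fourierInv_eq m f)
  rw [h0, conv_fourierInv_eq (dx m) f z]
  unfold HasLineDerivAt
  simp_rw [Real.fourierInv_eq']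
  have hG := integrable_schwartz_mul m (𝓕 f)
  have hG' := integrable_schwartz_mul (dx m) (𝓕 f)
  have hexp (c : ℂ) (x : ℝ) : ‖Complex.exp ((x : ℂ) * Complex.I) • c‖ = ‖c‖ := by
    rw [norm_smul, Complex.norm_exp_ofReal_mul_I, one_mul]
  have hc (w : Plane) : Continuous fun ζ : Plane =>
      Complex.exp (((2 * Real.pi * inner ℝ ζ w : ℝ) : ℂ) * Complex.I) := by fun_prop
  have key := hasDerivAt_integral_of_dominated_loc_of_deriv_le (μ := (volume : Measure Plane))
    (F := fun (t : ℝ) (ζ : Plane) =>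
      Complex.exp (((2 * Real.pi * inner ℝ ζ (z + t • e 0) : ℝ) : ℂ) * Complex.I) •
        (m ζ * (𝓕 f : L2C) ζ))
    (F' := fun (t : ℝ) (ζ : Plane) =>
      Complex.exp (((2 * Real.pi * inner ℝ ζ (z + t • e 0) : ℝ) : ℂ) * Complex.I) •
        (dx m ζ * (𝓕 f : L2C) ζ))
    (bound := fun ζ => ‖dx m ζ * (𝓕 f : L2C) ζ‖) (x₀ := 0) (s := univ) Filter.univ_mem
    (.of_forall fun t => (hc _).aestronglyMeasurable.smul hG.1)
    (hG.mono ((hc _).aestronglyMeasurable.smul hG.1) (.of_forall fun ζ => (hexp _ _).le))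
    ((hc _).aestronglyMeasurable.smul hG'.1)
    (.of_forall fun ζ t _ => (hexp _ _).le) hG'.norm
    (.of_forall fun ζ t _ => by
      have hd : HasDerivAt (fun t : ℝ => 2 * Real.pi * inner ℝ ζ (z + t • e 0))
          (2 * Real.pi * ζ 0) t := by
        have : (fun t : ℝ => 2 * Real.pi * inner ℝ ζ (z + t • e 0)) =
            fun t : ℝ => 2 * Real.pi * inner ℝ ζ z + t * (2 * Real.pi * ζ 0) := by
          ext t
          rw [inner_add_right, inner_smul_right]
          simp only [e, EuclideanSpace.inner_single_right]
          simp
          ring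
        rw [this]
        simpa using ((hasDerivAt_id t).mul_const (2 * Real.pi * ζ 0)).const_add
          (2 * Real.pi * inner ℝ ζ z)
      have h1 := ((hd.ofReal_comp.mul_const Complex.I).cexp).smul_const (m ζ * (𝓕 f : L2C) ζ)
      convert h1 using 1
      rw [dx_apply]
      simp only [smul_eq_mul]
      push_cast
      ring)
  simpa using key.2

theorem abs_le_of_hasLineDerivAt {q : Plane → ℝ} {c Q : ℝ} {z : Plane} (hQ : 0 ≤ Q)
    (h : HasLineDerivAt ℝ q c z (e 0)) (hq : ∀ y z, |q y - q z| ≤ Q * ‖y - z‖) : |c| ≤ Q := by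
  have := HasDerivAt.le_of_lip' (C := Q) h hQ (.of_forall fun t => ?_)
  · simpa using this
  · refine (hq _ _).trans (le_of_eq ?_)
    simp [norm_smul, e]

theorem ENNReal_mul_le_sq_add_sq (a b : ℝ≥0∞) : a * b ≤ a ^ 2 + b ^ 2 := by
  rcases le_total a b with h | h
  · exact (mul_le_mul_left h b).trans ((sq b).symm.le.trans le_add_self)
  · exact (mul_le_mul_right h a).trans ((sq a).symm.le.trans le_self_add)

section Transport

variable (m : 𝓢(Plane, ℂ)) {q qx h : Plane → ℝ}

theorem memLp_ofReal (hh : MemLp h 2) : MemLp (fun z => (h z : ℂ)) 2 := hh.ofReal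

theorem memLp_conv_schwartz (k : 𝓢(Plane, ℂ)) {f : Plane → ℂ} (hf : Measurable f)
    (hf2 : MemLp f 2) : MemLp (conv k f) 2 :=
  memLp_conv k.continuous.measurable hf k.integrable hf2

theorem lintegral_conv_kernel_le (hhm : Continuous h) :
    ∫⁻ z, ‖conv (𝓕⁻ m : 𝓢(Plane, ℂ)) (fun y => (h y : ℂ)) z‖ₑ ^ 2 ≤
      ENNReal.ofReal (kernelNorm m) ^ 2 * ∫⁻ z, ‖h z‖ₑ ^ 2 := by
  rw [← lintegral_enorm_fourierInv]
  refine (lintegral_enorm_conv_sq_le (𝓕⁻ m : 𝓢(Plane, ℂ)).continuous.measurable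
    (by fun_prop)).trans (le_of_eq ?_)
  simp only [← ofReal_norm, Complex.norm_real]

theorem hasLineDerivAt_conv_real (hh : MemLp h 2) (z : Plane) :
    HasLineDerivAt ℝ (conv (𝓕⁻ m : 𝓢(Plane, ℂ)) fun y => (h y : ℂ))
      (conv (𝓕⁻ (dx m) : 𝓢(Plane, ℂ)) (fun y => (h y : ℂ)) z) z (e 0) := by
  have := hasLineDerivAt_conv m ((memLp_ofReal hh).toLp _) z
  rwa [conv_congr_ae (MemLp.coeFn_toLp _), conv_congr_ae (MemLp.coeFn_toLp _)] at this

/-- The commutator has kernel `k (z - y) (q y - q z)`. The Lipschitz bound on `q` yields a factor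
`‖z - y‖`, which compensates the derivative in `k`. -/
theorem enorm_commutator_le {Q B : ℝ} (hQ : 0 ≤ Q) (hqc : Continuous q) (hB : ∀ z, |q z| ≤ B)
    (hq : ∀ y z, |q y - q z| ≤ Q * ‖y - z‖) (hh : MemLp h 2) (z : Plane) :
    ‖conv (𝓕⁻ (dx m) : 𝓢(Plane, ℂ)) (fun y => (q y * h y : ℂ)) z -
        q z * conv (𝓕⁻ (dx m) : 𝓢(Plane, ℂ)) (fun y => (h y : ℂ)) z‖ₑ ≤
      ENNReal.ofReal Q *
        ∫⁻ y, (‖z - y‖ₑ * ‖(𝓕⁻ (dx m) : 𝓢(Plane, ℂ)) (z - y)‖ₑ) * ‖h y‖ₑ := by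
  set k : 𝓢(Plane, ℂ) := 𝓕⁻ (dx m)
  have hi : Integrable fun y => k (z - y) * (h y : ℂ) := by
    have := ((reflect z k).memLp 2 volume).integrable_mul (memLp_ofReal hh)
    simpa only [Pi.mul_def, reflect_apply] using this
  have hi2 : Integrable fun y => k (z - y) * (q y * h y : ℂ) := by
    have := hi.bdd_mul (f := fun y => (q y : ℂ)) (c := B) (by fun_prop)
      (.of_forall fun y => by simpa using hB y)
    refine this.congr (.of_forall fun y => ?_)
    ring
  rw [conv, conv, ← integral_const_mul, ← integral_sub hi2 (hi.const_mul _)]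
  refine (enorm_integral_le_lintegral_enorm _).trans ?_
  rw [← lintegral_const_mul' _ _ ENNReal.ofReal_ne_top]
  refine lintegral_mono fun y => ?_
  have e : k (z - y) * (q y * h y : ℂ) - q z * (k (z - y) * h y) =
      ((q y - q z : ℝ) : ℂ) * k (z - y) * h y := by push_cast; ring
  have e2 : ‖((q y - q z : ℝ) : ℂ)‖ₑ ≤ ENNReal.ofReal Q * ‖z - y‖ₑ := by
    rw [← ofReal_norm, ← ofReal_norm, ← ENNReal.ofReal_mul hQ, Complex.norm_real, norm_sub_rev z y]
    exact ENNReal.ofReal_le_ofReal (hq y z)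
  rw [e, enorm_mul, enorm_mul, ← mul_assoc, ← mul_assoc]
  gcongr
  simp only [← ofReal_norm, Complex.norm_real, le_refl]

/-- Here the second convolution is `∂ₓ` of the first, `V`. Since `Re (conj V · ∂ₓ V) = ∂ₓ |V|² / 2`,
integration by parts leaves `-(1/2) ∫ q_x |V|²`, and `|q_x| ≤ Q`. -/
theorem enorm_integral_transport_le {Q B : ℝ} (hQ : 0 ≤ Q) (hqc : Continuous q)
    (hB : ∀ z, |q z| ≤ B) (hq : ∀ y z, |q y - q z| ≤ Q * ‖y - z‖) (hqx : Continuous qx)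
    (hd : ∀ z, HasLineDerivAt ℝ q (qx z) z (e 0)) (hhm : Continuous h) (hh : MemLp h 2) :
    ‖∫ z, q z * ((starRingEnd ℂ) (conv (𝓕⁻ m : 𝓢(Plane, ℂ)) (fun y => (h y : ℂ)) z) *
        conv (𝓕⁻ (dx m) : 𝓢(Plane, ℂ)) (fun y => (h y : ℂ)) z).re‖ₑ ≤
      ENNReal.ofReal Q * (ENNReal.ofReal (kernelNorm m) ^ 2 * ∫⁻ z, ‖h z‖ₑ ^ 2) := by
  set V := conv (𝓕⁻ m : 𝓢(Plane, ℂ)) fun y => (h y : ℂ) with hV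
  set W := conv (𝓕⁻ (dx m) : 𝓢(Plane, ℂ)) fun y => (h y : ℂ) with hW
  have hhc : Measurable fun y => (h y : ℂ) := by fun_prop
  have hV2 : MemLp V 2 := memLp_conv_schwartz _ hhc (memLp_ofReal hh)
  have hW2 : MemLp W 2 := memLp_conv_schwartz _ hhc (memLp_ofReal hh)
  have hVW : Integrable fun z => ((starRingEnd ℂ) (V z) * W z).re :=
    (hV2.star.integrable_mul hW2).re
  have hVV : Integrable fun z => ‖V z‖ ^ 2 := hV2.integrable_norm_pow (by norm_num)
  have hqx' (z) : |qx z| ≤ Q := abs_le_of_hasLineDerivAt hQ (hd z) hq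
  have hdP (z : Plane) : HasLineDerivAt ℝ (fun z => ‖V z‖ ^ 2)
      (2 * ((starRingEnd ℂ) (V z) * W z).re) z (e 0) := by
    have h1 : HasDerivAt (fun t : ℝ => V (z + t • e 0)) (W z) 0 :=
      hasLineDerivAt_conv_real m hh z
    have h2 := h1.norm_sq
    simp only [zero_smul, add_zero] at h2
    have h3 : inner ℝ (V z) (W z) = ((starRingEnd ℂ) (V z) * W z).re := by
      rw [Complex.inner, mul_comm]
    rw [h3] at h2
    exact h2
  have ibp := integral_bilinear_hasLineDerivAt_right_eq_neg_left_of_integrable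
    (μ := (volume : Measure Plane)) (B := ContinuousLinearMap.mul ℝ ℝ) (f := q) (f' := qx)
    (g := fun z => ‖V z‖ ^ 2) (g' := fun z => 2 * ((starRingEnd ℂ) (V z) * W z).re) (v := e 0)
    (hVV.bdd_mul (c := Q) hqx.aestronglyMeasurable (.of_forall hqx'))
    ((hVW.const_mul 2).bdd_mul (c := B) hqc.aestronglyMeasurable (.of_forall hB))
    (hVV.bdd_mul (c := B) hqc.aestronglyMeasurable (.of_forall hB))
    (fun z _ => hd z) (fun z _ => hdP z)
  simp only [ContinuousLinearMap.mul_apply'] at ibp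
  have e1 : ∫ z, q z * ((starRingEnd ℂ) (V z) * W z).re =
      -(1 / 2) * ∫ z, qx z * ‖V z‖ ^ 2 := by
    have : ∫ z, q z * (2 * ((starRingEnd ℂ) (V z) * W z).re) =
        2 * ∫ z, q z * ((starRingEnd ℂ) (V z) * W z).re := by
      rw [← integral_const_mul]
      congr 1 with z
      ring
    linarith
  have e2 : ‖∫ z, q z * ((starRingEnd ℂ) (V z) * W z).re‖ₑ ≤ ‖∫ z, qx z * ‖V z‖ ^ 2‖ₑ := by
    rw [e1, ← ofReal_norm, ← ofReal_norm]
    refine ENNReal.ofReal_le_ofReal ?_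
    rw [norm_mul]
    have := abs_nonneg (∫ z, qx z * ‖V z‖ ^ 2)
    norm_num
    linarith
  refine e2.trans ((enorm_integral_le_lintegral_enorm _).trans ?_)
  calc ∫⁻ z, ‖qx z * ‖V z‖ ^ 2‖ₑ ≤ ∫⁻ z, ENNReal.ofReal Q * ‖V z‖ₑ ^ 2 := by
        refine lintegral_mono fun z => ?_
        rw [enorm_mul, enorm_pow, enorm_norm]
        gcongr
        rw [← ofReal_norm]
        exact ENNReal.ofReal_le_ofReal (hqx' z)
    _ = ENNReal.ofReal Q * ∫⁻ z, ‖V z‖ₑ ^ 2 := lintegral_const_mul' _ _ ENNReal.ofReal_ne_top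
    _ ≤ _ := by
      gcongr
      exact lintegral_conv_kernel_le m hhm

/-- The multiplier applied to `q h` is split into `q` times the multiplier applied to `h`, which is
the transport term, and the commutator. One square of `kernelNorm` comes from the transport term,
the other from separating the two factors of the commutator term by `a b ≤ a² + b²`. -/
theorem enorm_re_integral_conv_le {Q B : ℝ} (hQ : 0 ≤ Q) (hqc : Continuous q)
    (hB : ∀ z, |q z| ≤ B) (hq : ∀ y z, |q y - q z| ≤ Q * ‖y - z‖) (hqx : Continuous qx)
    (hd : ∀ z, HasLineDerivAt ℝ q (qx z) z (e 0)) (hhm : Continuous h) (hh : MemLp h 2) :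
    ‖∫ z, ((starRingEnd ℂ) (conv (𝓕⁻ m : 𝓢(Plane, ℂ)) (fun y => (h y : ℂ)) z) *
        conv (𝓕⁻ (dx m) : 𝓢(Plane, ℂ)) (fun y => (q y * h y : ℂ)) z).re‖ₑ ≤
      ENNReal.ofReal Q * (2 * ENNReal.ofReal (kernelNorm m) ^ 2 +
        ENNReal.ofReal (kernelMoment m) ^ 2) * ∫⁻ z, ‖h z‖ₑ ^ 2 := by
  have main := enorm_integral_transport_le m hQ hqc hB hq hqx hd hhm hh
  set V := conv (𝓕⁻ m : 𝓢(Plane, ℂ)) fun y => (h y : ℂ) with hV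
  set W := conv (𝓕⁻ (dx m) : 𝓢(Plane, ℂ)) fun y => (h y : ℂ) with hW
  set N := conv (𝓕⁻ (dx m) : 𝓢(Plane, ℂ)) fun y => (q y * h y : ℂ) with hN
  have hhc : Measurable fun y => (h y : ℂ) := by fun_prop
  have hqh : MemLp (fun y => (q y * h y : ℂ)) 2 :=
    (memLp_ofReal hh).of_le_mul (c := B) (by fun_prop) (.of_forall fun y => by
      rw [norm_mul]
      gcongr
      simpa using hB y)
  have hV2 : MemLp V 2 := memLp_conv_schwartz _ hhc (memLp_ofReal hh)
  have hW2 : MemLp W 2 := memLp_conv_schwartz _ hhc (memLp_ofReal hh)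
  have hN2 : MemLp N 2 := memLp_conv_schwartz _ (by fun_prop) hqh
  have hVW : Integrable fun z => q z * ((starRingEnd ℂ) (V z) * W z).re :=
    (hV2.star.integrable_mul hW2).re.bdd_mul (c := B) hqc.aestronglyMeasurable (.of_forall hB)
  have hVN : Integrable fun z => ((starRingEnd ℂ) (V z) * N z).re :=
    (hV2.star.integrable_mul hN2).re
  have split : ∫ z, ((starRingEnd ℂ) (V z) * N z).re =
      (∫ z, q z * ((starRingEnd ℂ) (V z) * W z).re) +
        ∫ z, ((starRingEnd ℂ) (V z) * (N z - q z * W z)).re := by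
    have : ∀ z, ((starRingEnd ℂ) (V z) * (N z - q z * W z)).re =
        ((starRingEnd ℂ) (V z) * N z).re - q z * ((starRingEnd ℂ) (V z) * W z).re := fun z => by
      rw [mul_sub, Complex.sub_re, ← Complex.re_ofReal_mul]
      congr 2
      ring
    simp_rw [this]
    rw [integral_sub hVN hVW]
    ring
  have hr : ‖∫ z, ((starRingEnd ℂ) (V z) * (N z - q z * W z)).re‖ₑ ≤
      ENNReal.ofReal Q * (ENNReal.ofReal (kernelNorm m) ^ 2 * (∫⁻ z, ‖h z‖ₑ ^ 2) +
        ENNReal.ofReal (kernelMoment m) ^ 2 * ∫⁻ z, ‖h z‖ₑ ^ 2) := by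
    refine (enorm_integral_le_lintegral_enorm _).trans ?_
    set k : 𝓢(Plane, ℂ) := 𝓕⁻ (dx m) with hk
    have hkm : Measurable fun y : Plane => ‖y‖ₑ * ‖k y‖ₑ :=
      measurable_id.enorm.mul k.continuous.measurable.enorm
    calc _ ≤ ∫⁻ z, ENNReal.ofReal Q * (‖V z‖ₑ ^ 2 +
          (∫⁻ y, (‖z - y‖ₑ * ‖k (z - y)‖ₑ) * ‖h y‖ₑ) ^ 2) := by
          refine lintegral_mono fun z => ?_
          calc _ ≤ ‖(starRingEnd ℂ) (V z) * (N z - q z * W z)‖ₑ := by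
                rw [← ofReal_norm, ← ofReal_norm]
                exact ENNReal.ofReal_le_ofReal (Complex.abs_re_le_norm _)
            _ = ‖V z‖ₑ * ‖N z - q z * W z‖ₑ := by rw [enorm_mul, RCLike.enorm_conj]
            _ ≤ ‖V z‖ₑ * (ENNReal.ofReal Q *
                ∫⁻ y, (‖z - y‖ₑ * ‖k (z - y)‖ₑ) * ‖h y‖ₑ) := by
                gcongr
                exact enorm_commutator_le m hQ hqc hB hq hh z
            _ = ENNReal.ofReal Q * (‖V z‖ₑ * ∫⁻ y, (‖z - y‖ₑ * ‖k (z - y)‖ₑ) * ‖h y‖ₑ) := by ring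
            _ ≤ _ := by
                gcongr
                exact ENNReal_mul_le_sq_add_sq _ _
      _ = ENNReal.ofReal Q * ((∫⁻ z, ‖V z‖ₑ ^ 2) + ∫⁻ z,
          (∫⁻ y, (‖z - y‖ₑ * ‖k (z - y)‖ₑ) * ‖h y‖ₑ) ^ 2) := by
          rw [lintegral_const_mul' _ _ ENNReal.ofReal_ne_top, lintegral_add_left]
          exact (measurable_conv (𝓕⁻ m : 𝓢(Plane, ℂ)).continuous.measurable hhc).enorm.pow_const 2
      _ ≤ _ := by
          gcongr
          · exact lintegral_conv_kernel_le m hhm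
          · refine (lintegral_conv_sq_le hkm hhm.measurable.enorm).trans (le_of_eq ?_)
            rw [hk, lintegral_enorm_kernelMoment]
  rw [split]
  calc _ ≤ _ := enorm_add_le _ _
    _ ≤ _ := add_le_add main hr
    _ = _ := by ring

end Transport

end BO2

namespace BO2

/-! ### Regularity of the members of `W^{1,∞}` -/

theorem norm_zeroAtInfty_le (f : C₀(Plane, ℝ)) (z : Plane) : |f z| ≤ ‖f‖ := by
  rw [← Real.norm_eq_abs, ← ZeroAtInftyContinuousMap.norm_toBCF_eq_norm]
  exact f.toBCF.norm_coe_le_norm z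

theorem continuous_eval_zeroAtInfty (z : Plane) : Continuous fun f : C₀(Plane, ℝ) => f z := by
  refine (LipschitzWith.of_dist_le_mul (K := 1) fun f g => ?_).continuous
  rw [dist_eq_norm, dist_eq_norm, NNReal.coe_one, one_mul]
  exact norm_zeroAtInfty_le (f - g) z

theorem gradNorm_nonneg (F : Jet) : 0 ≤ gradNorm F := by unfold gradNorm; positivity

theorem continuous_gradNorm : Continuous gradNorm := by unfold gradNorm; fun_prop

theorem lipschitz_schwartzJet (f : 𝓢(Plane, ℝ)) (y z : Plane) :
    |f y - f z| ≤ gradNorm (schwartzJet f) * ‖y - z‖ := by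
  have hb (x : Plane) : ‖fderiv ℝ f x‖ ≤ gradNorm (schwartzJet f) := by
    refine ContinuousLinearMap.opNorm_le_bound _ (gradNorm_nonneg _) fun v => ?_
    have hv : v = v 0 • e 0 + v 1 • e 1 := by
      ext i
      fin_cases i <;> simp [e]
    have h0 : |fderiv ℝ f x (e 0)| ≤ ‖(schwartzJet f).2.1‖ :=
      norm_zeroAtInfty_le (∂_{e 0} f).toZeroAtInfty x
    have h1 : |fderiv ℝ f x (e 1)| ≤ ‖(schwartzJet f).2.2‖ :=
      norm_zeroAtInfty_le (∂_{e 1} f).toZeroAtInfty x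
    have e0 : |v 0| ≤ ‖v‖ := by simpa using PiLp.norm_apply_le v 0
    have e1 : |v 1| ≤ ‖v‖ := by simpa using PiLp.norm_apply_le v 1
    calc ‖fderiv ℝ f x v‖ = |v 0 * fderiv ℝ f x (e 0) + v 1 * fderiv ℝ f x (e 1)| := by
          conv_lhs => rw [hv]
          simp
      _ ≤ |v 0| * |fderiv ℝ f x (e 0)| + |v 1| * |fderiv ℝ f x (e 1)| := by
          rw [← abs_mul, ← abs_mul]
          exact abs_add_le _ _
      _ ≤ ‖v‖ * ‖(schwartzJet f).2.1‖ + ‖v‖ * ‖(schwartzJet f).2.2‖ := by gcongr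
      _ = _ := by unfold gradNorm; ring
  simpa using convex_univ.norm_image_sub_le_of_norm_fderiv_le (𝕜 := ℝ) (f := f) (x := z) (y := y)
    (fun x _ => f.differentiableAt) (fun x _ => hb x) (mem_univ _) (mem_univ _)

/-- For fixed points the inequality is a closed condition on the jet, and it holds for Schwartz
functions by the mean value inequality. -/
theorem lipschitz_of_mem_W1Inf {F : Jet} (hF : F ∈ W1Inf) (y z : Plane) :
    |F.1 y - F.1 z| ≤ gradNorm F * ‖y - z‖ := by
  have hc : IsClosed {F : Jet | |F.1 y - F.1 z| ≤ gradNorm F * ‖y - z‖} := by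
    refine isClosed_le ?_ (continuous_gradNorm.mul continuous_const)
    exact (((continuous_eval_zeroAtInfty y).comp continuous_fst).sub
      ((continuous_eval_zeroAtInfty z).comp continuous_fst)).abs
  refine closure_minimal ?_ hc hF
  rintro _ ⟨f, rfl⟩
  exact lipschitz_schwartzJet f y z

/-- Along the line through `z`, the approximating Schwartz functions converge pointwise and their
derivatives uniformly, so the limit may be differentiated. -/
theorem hasLineDerivAt_of_mem_W1Inf {F : Jet} (hF : F ∈ W1Inf) (z : Plane) :
    HasLineDerivAt ℝ F.1 (F.2.1 z) z (e 0) := by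
  obtain ⟨x, hx, hlim⟩ := mem_closure_iff_seq_limit.1 hF
  choose f hf using hx
  have hl (G : Jet) : ∀ w, |G.2.1 w| ≤ ‖G‖ := fun w =>
    (norm_zeroAtInfty_le _ w).trans ((norm_fst_le _).trans (norm_snd_le G))
  have hu : TendstoUniformly (fun (n : ℕ) (t : ℝ) => (∂_{e 0} (f n)) (z + t • e 0))
      (fun t => F.2.1 (z + t • e 0)) Filter.atTop := by
    rw [Metric.tendstoUniformly_iff]
    intro ε hε
    filter_upwards [(Metric.tendsto_nhds.1 hlim) ε hε] with n hn t
    rw [dist_comm, Real.dist_eq]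
    rw [dist_eq_norm, ← hf] at hn
    exact (hl (schwartzJet (f n) - F) _).trans_lt hn
  have hd : ∀ᶠ n in Filter.atTop, ∀ t : ℝ, HasDerivAt (fun t : ℝ => f n (z + t • e 0))
      ((∂_{e 0} (f n)) (z + t • e 0)) t := by
    refine .of_forall fun n t => ?_
    have h1 := (f n).hasFDerivAt (z + t • e 0)
    have h2 : HasDerivAt (fun t : ℝ => z + t • e 0) (e 0) t := by
      simpa using ((hasDerivAt_id t).smul_const (e 0)).const_add z
    exact h1.comp_hasDerivAt t h2
  have hp : ∀ t : ℝ, Filter.Tendsto (fun n => f n (z + t • e 0)) Filter.atTop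
      (nhds (F.1 (z + t • e 0))) := fun t => by
    have := (((continuous_eval_zeroAtInfty (z + t • e 0)).comp continuous_fst).tendsto F).comp hlim
    refine this.congr fun n => ?_
    simp only [Function.comp_apply, ← hf]
    rfl
  have := hasDerivAt_of_tendstoUniformly hu hd hp 0
  simpa [HasLineDerivAt] using this

theorem toComplex_ae_eq (f : L2R) : (toComplex f : Plane → ℂ) =ᵐ[volume] fun z => (f z : ℂ) :=
  ContinuousLinearMap.coeFn_compLp Complex.ofRealCLM f

end BO2

namespace BO2

/-! ### The nonlinear term at a dyadic frequency -/

theorem integrable_schwartz_sub_mul (k : 𝓢(Plane, ℂ)) {f : Plane → ℂ} (hf : Integrable f)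
    (z : Plane) : Integrable fun y => k (z - y) * f y := by
  have h := hf.bdd_mul (f := fun y => reflect z k y) (c := ‖k.toBoundedContinuousFunction‖)
    (reflect z k).continuous.aestronglyMeasurable
    (.of_forall fun y => by
      rw [reflect_apply]
      exact k.toBoundedContinuousFunction.norm_coe_le_norm _)
  simpa only [reflect_apply] using h

theorem integrable_schwartz_sub_mul_of_memLp (k : 𝓢(Plane, ℂ)) {f : Plane → ℂ}
    (hf : MemLp f 2) (z : Plane) : Integrable fun y => k (z - y) * f y := by
  have := ((reflect z k).memLp 2 volume).integrable_mul hf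
  simpa only [Pi.mul_def, reflect_apply] using this

/-- By `h0` and `h0'` the multiplier does not see `g` or `g²`. So `f` may be replaced by `f - g` and
`f²/2` by `(f² - g²)/2 = q (f - g)`, where `q = (f + g)/2` has Lipschitz constant `(A + A')/2`. -/
theorem enorm_re_integral_sq_le (m : 𝓢(Plane, ℂ)) {f fx g gx : Plane → ℝ} {A A' B B' : ℝ}
    (hA : 0 ≤ A) (hA' : 0 ≤ A')
    (hf : Continuous f) (hfB : ∀ z, |f z| ≤ B) (hfA : ∀ y z, |f y - f z| ≤ A * ‖y - z‖)
    (hfx : Continuous fx) (hfd : ∀ z, HasLineDerivAt ℝ f (fx z) z (e 0)) (hf2 : MemLp f 2)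
    (hg : Continuous g) (hgB : ∀ z, |g z| ≤ B') (hgA : ∀ y z, |g y - g z| ≤ A' * ‖y - z‖)
    (hgx : Continuous gx) (hgd : ∀ z, HasLineDerivAt ℝ g (gx z) z (e 0)) (hg2 : MemLp g 2)
    (h0 : ∀ z, conv (𝓕⁻ m : 𝓢(Plane, ℂ)) (fun y => (g y : ℂ)) z = 0)
    (h0' : ∀ z, conv (𝓕⁻ (dx m) : 𝓢(Plane, ℂ)) (fun y => (g y : ℂ) ^ 2) z = 0) :
    ‖∫ z, ((starRingEnd ℂ) (conv (𝓕⁻ m : 𝓢(Plane, ℂ)) (fun y => (f y : ℂ)) z) *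
        ((1 / 2) * conv (𝓕⁻ (dx m) : 𝓢(Plane, ℂ)) (fun y => (f y : ℂ) ^ 2) z)).re‖ₑ ≤
      ENNReal.ofReal ((A + A') / 2) * (2 * ENNReal.ofReal (kernelNorm m) ^ 2 +
        ENNReal.ofReal (kernelMoment m) ^ 2) * ∫⁻ z, ‖f z - g z‖ₑ ^ 2 := by
  have key := enorm_re_integral_conv_le m (q := fun z => (f z + g z) / 2)
    (qx := fun z => (fx z + gx z) / 2) (h := fun z => f z - g z) (Q := (A + A') / 2)
    (B := (B + B') / 2) (by positivity) (by fun_prop)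
    (fun z => by
      have := abs_le.1 (hfB z); have := abs_le.1 (hgB z)
      rw [abs_le]; constructor <;> linarith)
    (fun y z => by
      have := abs_le.1 (hfA y z); have := abs_le.1 (hgA y z)
      rw [abs_le]; constructor <;> linarith)
    (by fun_prop)
    (fun z => by
      have := ((hfd z : HasDerivAt _ _ _).add (hgd z : HasDerivAt _ _ _)).div_const 2
      exact this)
    (by fun_prop) (hf2.sub hg2)
  refine le_trans (le_of_eq ?_) key
  congr 1
  refine integral_congr_ae (.of_forall fun z => ?_)
  have e1 : conv (𝓕⁻ m : 𝓢(Plane, ℂ)) (fun y => (f y : ℂ)) z =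
      conv (𝓕⁻ m : 𝓢(Plane, ℂ)) (fun y => ((f y - g y : ℝ) : ℂ)) z := by
    have hs : conv (𝓕⁻ m : 𝓢(Plane, ℂ)) (fun y => ((f y - g y : ℝ) : ℂ)) z =
        conv (𝓕⁻ m : 𝓢(Plane, ℂ)) (fun y => (f y : ℂ)) z -
          conv (𝓕⁻ m : 𝓢(Plane, ℂ)) (fun y => (g y : ℂ)) z := by
      unfold conv
      rw [← integral_sub (integrable_schwartz_sub_mul_of_memLp _ (memLp_ofReal hf2) z)
        (integrable_schwartz_sub_mul_of_memLp _ (memLp_ofReal hg2) z)]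
      congr 1 with y
      push_cast; ring
    rw [hs, h0, sub_zero]
  have e2 : (1 / 2) * conv (𝓕⁻ (dx m) : 𝓢(Plane, ℂ)) (fun y => (f y : ℂ) ^ 2) z =
      conv (𝓕⁻ (dx m) : 𝓢(Plane, ℂ))
        (fun y => (((f y + g y) / 2 : ℝ) * (f y - g y : ℝ) : ℂ)) z := by
    have hi {u : Plane → ℝ} (hu : MemLp u 2) : Integrable fun y => (u y : ℂ) ^ 2 := by
      have := (memLp_ofReal hu).integrable_mul (memLp_ofReal hu)
      exact this.congr (.of_forall fun y => (sq _).symm)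
    have hs : conv (𝓕⁻ (dx m) : 𝓢(Plane, ℂ))
        (fun y => (((f y + g y) / 2 : ℝ) * (f y - g y : ℝ) : ℂ)) z = (1 / 2) *
        (conv (𝓕⁻ (dx m) : 𝓢(Plane, ℂ)) (fun y => (f y : ℂ) ^ 2) z -
          conv (𝓕⁻ (dx m) : 𝓢(Plane, ℂ)) (fun y => (g y : ℂ) ^ 2) z) := by
      unfold conv
      rw [← integral_sub (integrable_schwartz_sub_mul _ (hi hf2) z)
        (integrable_schwartz_sub_mul _ (hi hg2) z), ← integral_const_mul]
      congr 1 with y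
      push_cast; ring
    rw [hs, h0', sub_zero]
  simp only [e1, e2]

theorem lintegral_enorm_sq_eq_of_ae_eq {H : L2C} {h : Plane → ℝ}
    (hH : (H : Plane → ℂ) =ᵐ[volume] fun z => (h z : ℂ)) : ∫⁻ z, ‖h z‖ₑ ^ 2 = ‖H‖ₑ ^ 2 := by
  rw [enorm_sq_eq_lintegral]
  refine lintegral_congr_ae ?_
  filter_upwards [hH] with z hz
  rw [hz, ← ofReal_norm, ← ofReal_norm, Complex.norm_real]

theorem abs_conv_lowSymbol_le (r : ℕ) {f : Plane → ℝ} {B : ℝ} (hfB : ∀ z, |f z| ≤ B) (z : Plane) :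
    ‖conv (𝓕⁻ (lowSymbol r) : 𝓢(Plane, ℂ)) (fun y => (f y : ℂ)) z‖ ≤
      kernelNorm (lowSymbol r) * B := by
  rw [conv_comm, conv, kernelNorm, ← integral_mul_const]
  refine norm_integral_le_of_norm_le ((𝓕⁻ (lowSymbol r) : 𝓢(Plane, ℂ)).integrable.norm.mul_const B)
    (.of_forall fun y => ?_)
  rw [norm_mul, mul_comm, Complex.norm_real]
  gcongr
  exact hfB _

/-- Convolution commutes with translations, so it multiplies a Lipschitz constant by at most the
`L¹` norm of the kernel, which does not depend on `r`. -/
theorem norm_conv_lowSymbol_sub_le (r : ℕ) {f : Plane → ℝ} {A B : ℝ} (hf : Continuous f)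
    (hfB : ∀ z, |f z| ≤ B) (hfA : ∀ y z, |f y - f z| ≤ A * ‖y - z‖) (y z : Plane) :
    ‖conv (𝓕⁻ (lowSymbol r) : 𝓢(Plane, ℂ)) (fun y => (f y : ℂ)) y -
      conv (𝓕⁻ (lowSymbol r) : 𝓢(Plane, ℂ)) (fun y => (f y : ℂ)) z‖ ≤
      kernelNorm (lowSymbol r) * A * ‖y - z‖ := by
  have hK := (𝓕⁻ (lowSymbol r) : 𝓢(Plane, ℂ)).integrable (μ := volume)
  have hi (z : Plane) :
      Integrable fun w => (f (z - w) : ℂ) * (𝓕⁻ (lowSymbol r) : 𝓢(Plane, ℂ)) w :=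
    hK.bdd_mul (c := B) (by fun_prop) (.of_forall fun w => by simpa using hfB (z - w))
  rw [conv_comm, conv_comm _ _ z, conv, conv, ← integral_sub (hi y) (hi z), kernelNorm, mul_assoc,
    ← integral_mul_const]
  refine norm_integral_le_of_norm_le (hK.norm.mul_const _) (.of_forall fun w => ?_)
  rw [← sub_mul, norm_mul, mul_comm, ← Complex.ofReal_sub, Complex.norm_real]
  gcongr
  simpa using hfA (y - w) (z - w)

theorem ofReal_re_conv_lowSymbol (r : ℕ) (f : Plane → ℝ) (z : Plane) :
    (((conv (𝓕⁻ (lowSymbol r) : 𝓢(Plane, ℂ)) (fun y => (f y : ℂ)) z).re : ℝ) : ℂ) =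
      conv (𝓕⁻ (lowSymbol r) : 𝓢(Plane, ℂ)) (fun y => (f y : ℂ)) z := by
  rw [← Complex.conj_eq_iff_re, conv, ← integral_conj]
  simp [conj_kernel_lowSymbol]

/-- The nonlinear term `Δ_λ (f²/2)_x`, `λ = 2 ^ j`. -/
def nonlinear (P : DyadicPartition) (j : ℕ) (f : Plane → ℂ) (z : Plane) : ℂ :=
  (1 / 2) * conv (𝓕⁻ (dx (P.blockSymbol j)) : 𝓢(Plane, ℂ)) (fun y => f y ^ 2) z

theorem dx_eq_zero {m : 𝓢(Plane, ℂ)} {ζ : Plane} (h : m ζ = 0) : dx m ζ = 0 := by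
  rw [dx_apply, h]; ring

/-- The trilinear estimate. The low-frequency part of `f` enters only through its Lipschitz
constant; the quadratic factor is the remainder at frequencies at least `2 ^ (j - 3)`, which
accounts for the range `j ≤ i + 3`. -/
theorem exists_enorm_re_integral_nonlinear_le (P : DyadicPartition) :
    ∃ C : ℝ, 0 ≤ C ∧ ∀ (f : L2R) (F : Jet), F ∈ W1Inf → (f : Plane → ℝ) =ᵐ[volume] F.1 → ∀ j,
      ‖∫ z, ((starRingEnd ℂ) (P.block j (toComplex f) z) *
        nonlinear P j (toComplex f) z).re‖ₑ ≤ ENNReal.ofReal (C * gradNorm F) *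
        ∑' i, if j ≤ i + 3 then ‖P.block i (toComplex f)‖ₑ ^ 2 else 0 := by
  obtain ⟨M, hM, hMb⟩ := P.exists_kernel_bound
  set κ := kernelNorm (lowSymbol 0) with hκ
  have hκ0 : 0 ≤ κ := integral_nonneg fun z => norm_nonneg _
  -- `(1 + κ) / 2` comes from the Lipschitz constant of `(f + g)/2`, `2 M² + M²` from the block
  -- kernels, and the last `2` from almost orthogonality.
  refine ⟨(1 + κ) / 2 * (2 * M ^ 2 + M ^ 2) * 2, by positivity, fun f F hF hfF j => ?_⟩
  have hA := gradNorm_nonneg F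
  set A := gradNorm F
  have hfc : (toComplex f : Plane → ℂ) =ᵐ[volume] fun z => (F.1 z : ℂ) := by
    filter_upwards [toComplex_ae_eq f, hfF] with z h1 h2
    rw [h1, h2]
  have hF2 : MemLp F.1 2 := (memLp_congr_ae hfF).1 (Lp.memLp f)
  have hFA := lipschitz_of_mem_W1Inf hF
  have hFd := hasLineDerivAt_of_mem_W1Inf hF
  have hFB : ∀ z, |F.1 z| ≤ ‖F.1‖ := norm_zeroAtInfty_le F.1
  set m := P.blockSymbol j with hm
  have hb : (P.block j (toComplex f) : Plane → ℂ) =ᵐ[volume]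
      conv (𝓕⁻ m : 𝓢(Plane, ℂ)) (fun y => (F.1 y : ℂ)) := by
    rw [P.block_eq_mult, ← conv_congr_ae hfc]
    exact mult_ae_eq_conv _ _ _
  have hn : nonlinear P j (toComplex f) = fun z => (1 / 2) *
      conv (𝓕⁻ (dx m) : 𝓢(Plane, ℂ)) (fun y => (F.1 y : ℂ) ^ 2) z := by
    ext z
    rw [nonlinear, conv_congr_ae (f := fun y => toComplex f y ^ 2)]
    filter_upwards [hfc] with y hy
    rw [hy]
  have hint : ∫ z, ((starRingEnd ℂ) (P.block j (toComplex f) z) *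
        nonlinear P j (toComplex f) z).re =
      ∫ z, ((starRingEnd ℂ) (conv (𝓕⁻ m : 𝓢(Plane, ℂ)) (fun y => (F.1 y : ℂ)) z) *
        ((1 / 2) * conv (𝓕⁻ (dx m) : 𝓢(Plane, ℂ)) (fun y => (F.1 y : ℂ) ^ 2) z)).re := by
    refine integral_congr_ae ?_
    filter_upwards [hb] with z hz
    rw [hz, hn]
  have hconst : ENNReal.ofReal ((A + κ * A) / 2) * (2 * ENNReal.ofReal (kernelNorm m) ^ 2 +
      ENNReal.ofReal (kernelMoment m) ^ 2) * 2 ≤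
      ENNReal.ofReal ((1 + κ) / 2 * (2 * M ^ 2 + M ^ 2) * 2 * A) := by
    have h1 := ENNReal.ofReal_le_ofReal (hMb j).1
    have h2 := ENNReal.ofReal_le_ofReal (hMb j).2
    calc _ ≤ ENNReal.ofReal ((A + κ * A) / 2) * (2 * ENNReal.ofReal M ^ 2 +
        ENNReal.ofReal M ^ 2) * 2 := by gcongr
      _ = ENNReal.ofReal ((A + κ * A) / 2 * (2 * M ^ 2 + M ^ 2) * 2) := by
        rw [ENNReal.ofReal_mul (by positivity), ENNReal.ofReal_mul (by positivity),
          ENNReal.ofReal_add (by positivity) (by positivity), ENNReal.ofReal_mul (by positivity),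
          ENNReal.ofReal_pow hM, ENNReal.ofReal_ofNat]
      _ = _ := by congr 1; ring
  have finish (g : Plane → ℝ) (H : L2C)
      (hH : (H : Plane → ℂ) =ᵐ[volume] fun z => ((F.1 z - g z : ℝ) : ℂ))
      (hHb : ‖H‖ₑ ^ 2 ≤ 2 * ∑' i, if j ≤ i + 3 then ‖P.block i (toComplex f)‖ₑ ^ 2 else 0)
      (key : ‖∫ z, ((starRingEnd ℂ) (conv (𝓕⁻ m : 𝓢(Plane, ℂ)) (fun y => (F.1 y : ℂ)) z) *
        ((1 / 2) * conv (𝓕⁻ (dx m) : 𝓢(Plane, ℂ)) (fun y => (F.1 y : ℂ) ^ 2) z)).re‖ₑ ≤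
      ENNReal.ofReal ((A + κ * A) / 2) * (2 * ENNReal.ofReal (kernelNorm m) ^ 2 +
        ENNReal.ofReal (kernelMoment m) ^ 2) * ∫⁻ z, ‖F.1 z - g z‖ₑ ^ 2) :
      ‖∫ z, ((starRingEnd ℂ) (P.block j (toComplex f) z) *
        nonlinear P j (toComplex f) z).re‖ₑ ≤ ENNReal.ofReal ((1 + κ) / 2 * (2 * M ^ 2 + M ^ 2) *
          2 * A) * ∑' i, if j ≤ i + 3 then ‖P.block i (toComplex f)‖ₑ ^ 2 else 0 := by
    rw [hint]
    refine key.trans ?_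
    rw [lintegral_enorm_sq_eq_of_ae_eq hH]
    calc _ ≤ _ := mul_le_mul_right hHb _
      _ = _ := (mul_assoc _ _ _).symm
      _ ≤ _ := mul_le_mul_left hconst _
  by_cases hj : 3 ≤ j
  · obtain ⟨r, rfl⟩ : ∃ r, j = r + 3 := ⟨j - 3, by omega⟩
    set σ := lowSymbol r with hσ
    set gc := conv (𝓕⁻ σ : 𝓢(Plane, ℂ)) (fun y => (F.1 y : ℂ)) with hgc
    set gcx := conv (𝓕⁻ (dx σ) : 𝓢(Plane, ℂ)) (fun y => (F.1 y : ℂ)) with hgcx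
    set g : Plane → ℝ := fun z => (gc z).re with hgdef
    have hg : ∀ z, (g z : ℂ) = gc z := ofReal_re_conv_lowSymbol r F.1
    have hgc' : gc = conv (𝓕⁻ σ : 𝓢(Plane, ℂ)) (toComplex f) := (conv_congr_ae hfc).symm
    have hgcx' : gcx = conv (𝓕⁻ (dx σ) : 𝓢(Plane, ℂ)) (toComplex f) := (conv_congr_ae hfc).symm
    set G : Plane → ℂ := fun ζ => σ ζ * (𝓕 (toComplex f) : L2C) ζ with hG
    have hgG : gc = 𝓕⁻ G := by
      rw [hgc']
      exact funext (conv_fourierInv_eq σ (toComplex f))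
    have hGi : Integrable G := integrable_schwartz_mul σ _
    have hGz (ζ : Plane) (h : G ζ ≠ 0) : σ ζ ≠ 0 := left_ne_zero_of_mul h
    set Gm := mult σ (σ.memLp_top volume) (toComplex f) with hGm
    have hGmg : (Gm : Plane → ℂ) =ᵐ[volume] gc := by
      rw [hgc']
      exact mult_ae_eq_conv _ _ _
    have hFc2 := memLp_ofReal hF2
    have hg2 : MemLp g 2 := by
      have : MemLp gc 2 := memLp_conv_schwartz _ (by fun_prop) hFc2
      exact this.re
    have hκr : kernelNorm σ = κ := kernelNorm_lowSymbol r
    refine finish g (toComplex f - Gm) ?_ ?_ ?_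
    · filter_upwards [Lp.coeFn_sub (toComplex f) Gm, hfc, hGmg] with z h1 h2 h3
      rw [h1, Pi.sub_apply, h2, h3, ← hg]
      push_cast; rfl
    · have := P.enorm_sq_le_tsum_block (f := toComplex f) (h := toComplex f - Gm) r ?_
      · simpa only [Nat.add_le_add_iff_right] using this
      have hs : (𝓕 (toComplex f - Gm) : L2C) = 𝓕 (toComplex f) - 𝓕 Gm :=
        (Lp.fourierTransformₗᵢ Plane ℂ).map_sub _ _
      rw [hs]
      filter_upwards [Lp.coeFn_sub (𝓕 (toComplex f) : L2C) (𝓕 Gm),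
        fourier_mult_ae_eq σ (σ.memLp_top volume) (toComplex f)] with ζ h1 h2
      rw [h1, Pi.sub_apply, h2, show (𝓕 (toComplex f) : L2C) ζ - σ ζ * (𝓕 (toComplex f) : L2C) ζ =
        (1 - σ ζ) * (𝓕 (toComplex f) : L2C) ζ by ring]
      refine ⟨?_, fun h => .inr (le_norm_of_lowSymbol_ne_one (left_ne_zero_of_mul h))⟩
      rw [enorm_mul]
      refine mul_le_of_le_one_left' ?_
      rw [← ofReal_norm, ← ENNReal.ofReal_one]
      exact ENNReal.ofReal_le_ofReal (norm_one_sub_lowSymbol_le r ζ)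
    · refine enorm_re_integral_sq_le m (fx := F.2.1) (gx := fun z => (gcx z).re) (B := ‖F.1‖)
        (B' := κ * ‖F.1‖) hA (by positivity) F.1.continuous hFB hFA F.2.1.continuous hFd hF2
        ?_ ?_ ?_ ?_ ?_ hg2 ?_ ?_
      · have : Continuous gc := by rw [hgc']; exact continuous_conv_fourierInv σ _
        exact Complex.continuous_re.comp this
      · intro z
        rw [← hκr]
        exact (Complex.abs_re_le_norm _).trans (abs_conv_lowSymbol_le r hFB z)
      · intro y z
        rw [← hκr, hgdef, ← Complex.sub_re]
        exact (Complex.abs_re_le_norm _).trans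
          (norm_conv_lowSymbol_sub_le r F.1.continuous hFB hFA y z)
      · have : Continuous gcx := by rw [hgcx']; exact continuous_conv_fourierInv (dx σ) _
        exact Complex.continuous_re.comp this
      · intro z
        have h1 : HasDerivAt (fun t : ℝ => gc (z + t • e 0)) (gcx z) 0 :=
          hasLineDerivAt_conv_real σ hF2 z
        exact Complex.reCLM.hasFDerivAt.comp_hasDerivAt (0 : ℝ) h1
      · intro z
        simp_rw [hg]
        change conv _ gc z = 0
        rw [hgG]
        exact conv_fourierInv_eq_zero m hGi
          (fun ζ h => P.blockSymbol_eq_zero_of_low le_rfl (hGz ζ h)) z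
      · intro z
        simp_rw [hg, hgG]
        exact conv_fourierInv_sq_eq_zero (dx m) hGi (fun ζ ζ' h h' => dx_eq_zero
          (P.blockSymbol_add_eq_zero_of_low le_rfl (hGz ζ h) (hGz ζ' h'))) z
  -- For `j < 3` nothing is subtracted: `j ≤ i + 3` holds for every `i`, so all of `f` is allowed on
  -- the right.
  · refine finish (fun _ => 0) (toComplex f) ?_ ?_ ?_
    · simpa using hfc
    · have := P.enorm_sq_le_tsum_block (f := toComplex f) (h := toComplex f) 0 (by simp)
      refine this.trans (le_of_eq ?_)
      congr 2 with i
      rw [if_pos (Nat.zero_le i), if_pos (by omega)]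
    · refine enorm_re_integral_sq_le m (fx := F.2.1) (gx := fun z => 0) (B := ‖F.1‖)
        (B' := 0) hA (by positivity) F.1.continuous hFB hFA F.2.1.continuous hFd hF2
        (by fun_prop) (by simp) (fun y z => by simp; positivity) (by fun_prop) ?_ (by simp)
        (by simp [conv]) (by simp [conv])
      intro z
      exact hasDerivAt_const (0 : ℝ) (0 : ℝ)

end BO2

namespace BO2

/-! ### The nonlinear term as a continuous map on `L²` -/

theorem lintegral_enorm_mul_le (f g : L2C) : ∫⁻ z, ‖f z * g z‖ₑ ≤ ‖f‖ₑ * ‖g‖ₑ := by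
  have hf := (Lp.stronglyMeasurable f).measurable.enorm.aemeasurable (μ := volume)
  have hg := (Lp.stronglyMeasurable g).measurable.enorm.aemeasurable (μ := volume)
  have h := ENNReal.lintegral_mul_le_Lp_mul_Lq volume Real.HolderConjugate.two_two hf hg
  have e (u : L2C) : (∫⁻ z, ‖u z‖ₑ ^ (2 : ℝ)) ^ (1 / 2 : ℝ) = ‖u‖ₑ := by
    simp only [ENNReal.rpow_two]
    rw [← enorm_sq_eq_lintegral, ← ENNReal.rpow_two, ← ENNReal.rpow_mul]
    norm_num
  rw [e, e] at h
  simpa only [Pi.mul_apply, enorm_mul] using h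

theorem integrable_mul_L2C (f g : L2C) : Integrable fun z => f z * g z :=
  (Lp.memLp f).integrable_mul (Lp.memLp g)

theorem memLp_conv_integrable (k : 𝓢(Plane, ℂ)) {F : Plane → ℂ} (hF : Measurable F)
    (hFi : Integrable F) : MemLp (conv k F) 2 := by
  have : conv k F = conv F k := funext (conv_comm k F)
  rw [this]
  exact memLp_conv hF k.continuous.measurable hFi (k.memLp 2 volume)

theorem measurable_L2C (f : L2C) : Measurable f := (Lp.stronglyMeasurable f).measurable

variable (P : DyadicPartition) (j : ℕ)

theorem memLp_nonlinear (f : L2C) : MemLp (nonlinear P j f) 2 := by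
  have hi := (integrable_mul_L2C f f).congr (.of_forall fun z => (sq (f z)).symm)
  exact (memLp_conv_integrable _ ((measurable_L2C f).pow_const 2) hi).const_mul _

/-- The nonlinear term `Δ_λ (f²/2)_x` as an element of `L²`. -/
def nonlinearL2 (f : L2C) : L2C := (memLp_nonlinear P j f).toLp _

/-- `f² - g² = (f - g)(f + g)` lies in `L¹` and the block kernel in `L²`, so Young's inequality
gives local Lipschitz continuity on `L²`. -/
theorem enorm_nonlinearL2_sub_le (f g : L2C) :
    ‖nonlinearL2 P j f - nonlinearL2 P j g‖ₑ ≤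
      (‖f - g‖ₑ * ‖f + g‖ₑ) * ‖(𝓕⁻ (dx (P.blockSymbol j)) : 𝓢(Plane, ℂ)).toLp 2‖ₑ := by
  set k : 𝓢(Plane, ℂ) := 𝓕⁻ (dx (P.blockSymbol j)) with hk
  rw [← ENNReal.pow_le_pow_left_iff two_ne_zero, mul_pow, enorm_sq_eq_lintegral,
    enorm_sq_eq_lintegral]
  have hF : Measurable fun z => (f - g) z * (f + g) z :=
    (measurable_L2C _).mul (measurable_L2C _)
  have hi (u : L2C) := (integrable_mul_L2C u u).congr (.of_forall fun z => (sq (u z)).symm)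
  have hFae : (fun z => (f - g) z * (f + g) z) =ᵐ[volume] fun z => f z ^ 2 - g z ^ 2 := by
    filter_upwards [Lp.coeFn_sub f g, Lp.coeFn_add f g] with z h1 h2
    rw [h1, h2, Pi.sub_apply, Pi.add_apply]
    ring
  have e1 : ((nonlinearL2 P j f - nonlinearL2 P j g : L2C) : Plane → ℂ) =ᵐ[volume] fun z =>
      (1 / 2) * conv k (fun z => (f - g) z * (f + g) z) z := by
    filter_upwards [Lp.coeFn_sub (nonlinearL2 P j f) (nonlinearL2 P j g),
      (memLp_nonlinear P j f).coeFn_toLp, (memLp_nonlinear P j g).coeFn_toLp] with z h1 h2 h3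
    rw [h1, Pi.sub_apply, nonlinearL2, nonlinearL2, h2, h3, nonlinear, nonlinear, ← mul_sub,
      conv_congr_ae hFae]
    congr 1
    unfold conv
    rw [← integral_sub (integrable_schwartz_sub_mul _ (hi f) z)
        (integrable_schwartz_sub_mul _ (hi g) z)]
    congr 1 with y
    ring
  have h12 : ‖(1 / 2 : ℂ)‖ₑ ≤ 1 := by
    rw [← ofReal_norm, ← ENNReal.ofReal_one]
    exact ENNReal.ofReal_le_ofReal (by norm_num)
  calc _ = ∫⁻ z, ‖(1 / 2) * conv k (fun z => (f - g) z * (f + g) z) z‖ₑ ^ 2 := by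
        refine lintegral_congr_ae ?_
        filter_upwards [e1] with z hz
        rw [hz]
    _ ≤ ∫⁻ z, ‖conv (fun z => (f - g) z * (f + g) z) k z‖ₑ ^ 2 := by
        refine lintegral_mono fun z => ?_
        rw [enorm_mul, conv_comm]
        gcongr
        exact mul_le_of_le_one_left' h12
    _ ≤ (∫⁻ z, ‖(f - g) z * (f + g) z‖ₑ) ^ 2 * ∫⁻ z, ‖k z‖ₑ ^ 2 :=
        lintegral_enorm_conv_sq_le hF k.continuous.measurable
    _ ≤ _ := by
        refine mul_le_mul' (pow_le_pow_left' (lintegral_enorm_mul_le _ _) 2) ?_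
        · refine le_of_eq (lintegral_congr_ae ?_)
          filter_upwards [k.coeFn_toLp 2 volume] with z hz
          rw [hz]

theorem continuous_nonlinearL2 : Continuous (nonlinearL2 P j) := by
  set c := ‖(𝓕⁻ (dx (P.blockSymbol j)) : 𝓢(Plane, ℂ)).toLp 2‖ with hc
  have h (f g : L2C) : ‖nonlinearL2 P j f - nonlinearL2 P j g‖ ≤ (‖f - g‖ * ‖f + g‖) * c := by
    have := ENNReal.toReal_mono (by finiteness) (enorm_nonlinearL2_sub_le P j f g)
    simpa [ENNReal.toReal_mul] using this
  rw [continuous_iff_continuousAt]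
  intro g
  rw [ContinuousAt, tendsto_iff_norm_sub_tendsto_zero]
  refine squeeze_zero (fun f => norm_nonneg _) (fun f => h f g) ?_
  have : Continuous fun f : L2C => (‖f - g‖ * ‖f + g‖) * c := by fun_prop
  simpa using this.tendsto g

/-! ### The dispersive term -/

/-- On the support of the block both frequency components are at most `R = 2 ^ (j + 1)`, so the
dispersive symbol is at most `R ^ α * R + R ^ 2` there. -/
theorem memLp_dispersion_blockSymbol {α : ℝ} (hα : 0 < α) :
    MemLp (fun ζ : Plane => dispersionSymbol α ((2 * Real.pi) • ζ) * P.blockSymbol j ζ) ⊤ := by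
  obtain ⟨M, hM⟩ : ∃ M : ℝ, ∀ ζ, ‖P.blockSymbol j ζ‖ ≤ M :=
    ⟨_, (P.blockSymbol j).toBoundedContinuousFunction.norm_coe_le_norm⟩
  have hmeas : Measurable (dispersionSymbol α) := by
    unfold dispersionSymbol
    have hs : Measurable Real.sign := by
      unfold Real.sign
      exact Measurable.ite measurableSet_Iio measurable_const
        (Measurable.ite measurableSet_Ioi measurable_const measurable_const)
    have h0 : Measurable fun ζ : Plane => ζ 0 := by fun_prop
    have h1 : Measurable fun ζ : Plane => Real.sign (ζ 0) := hs.comp h0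
    fun_prop
  set R : ℝ := 2 ^ (j + 1)
  refine memLp_top_of_bound ((hmeas.comp (measurable_const_smul _)).mul
    (P.blockSymbol j).continuous.measurable).aestronglyMeasurable ((R ^ α * R + R ^ 2) * M)
    (.of_forall fun ζ => ?_)
  by_cases h0 : P.blockSymbol j ζ = 0
  · rw [h0, mul_zero, norm_zero]
    have := (norm_nonneg _).trans (hM ζ)
    positivity
  have hR := (P.norm_lt_of_symbol_ne_zero (j := j) (ζ := (2 * Real.pi) • ζ)
    fun h => h0 (by rw [P.blockSymbol_apply, h, Complex.ofReal_zero])).le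
  set w := (2 * Real.pi) • ζ
  have hw (i : Fin 2) : |w i| ≤ R := by
    have := (PiLp.norm_apply_le w i).trans hR
    simpa using this
  have hsgn : |Real.sign (w 0)| ≤ 1 := by
    rcases Real.sign_apply_eq (w 0) with h | h | h <;> simp [h]
  rw [norm_mul]
  gcongr
  · refine (norm_add_le _ _).trans (add_le_add ?_ ?_)
    · rw [norm_mul, norm_mul, Complex.norm_I, one_mul, Complex.norm_real, Complex.norm_real,
        Real.norm_eq_abs, Real.norm_eq_abs, abs_of_nonneg (by positivity)]
      gcongr
      · exact hw 0
      · exact hw 0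
    · rw [norm_mul, norm_mul, norm_neg, norm_pow, norm_mul, Complex.norm_I, one_mul, one_mul,
        Complex.norm_real, Complex.norm_real, Real.norm_eq_abs, Real.norm_eq_abs]
      calc _ ≤ 1 * R ^ 2 := by gcongr; exact hw 1
        _ = _ := one_mul _
  · exact hM ζ

theorem dispersionSymbol_neg (α : ℝ) (ζ : Plane) :
    dispersionSymbol α (-ζ) = -dispersionSymbol α ζ := by
  simp only [dispersionSymbol, PiLp.neg_apply, abs_neg, Real.sign_neg, Complex.ofReal_neg]
  ring

theorem dispersionSymbol_re (α : ℝ) (ζ : Plane) : (dispersionSymbol α ζ).re = 0 := by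
  have : dispersionSymbol α ζ =
      ((|ζ 0| ^ α * ζ 0 + Real.sign (ζ 0) * ζ 1 ^ 2 : ℝ) : ℂ) * Complex.I := by
    unfold dispersionSymbol
    push_cast
    linear_combination (-Complex.I * Real.sign (ζ 0) * ζ 1 ^ 2) * Complex.I_sq
  rw [this, Complex.re_ofReal_mul, Complex.I_re, mul_zero]

/-- Applying `𝓕` twice reflects the argument, and the dispersive symbol is odd; this is the
antisymmetry of the operator. -/
theorem dispersion_fourier (α : ℝ) (Φ : 𝓢(Plane, ℂ)) :
    dispersion α (𝓕 Φ) =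
      -𝓕 (fun ζ : Plane => dispersionSymbol α ((2 * Real.pi) • ζ) * Φ ζ) := by
  have h (ζ : Plane) : (𝓕 (𝓕 Φ)) ζ = Φ (-ζ) := by
    have h1 : (𝓕⁻ (𝓕 Φ)) (-ζ) = Φ (-ζ) := by rw [FourierTransform.fourierInv_fourier_eq]
    rw [← h1, SchwartzMap.fourierInv_coe, Real.fourierInv_eq_fourier_neg, neg_neg,
      SchwartzMap.fourier_coe]
  have e1 : (fun ζ : Plane => dispersionSymbol α ((2 * Real.pi) • ζ) * (𝓕 (𝓕 Φ)) ζ) =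
      fun ζ => -(fun ζ : Plane => dispersionSymbol α ((2 * Real.pi) • ζ) * Φ ζ) (-ζ) := by
    ext ζ
    simp only [h, smul_neg, dispersionSymbol_neg]
    ring
  rw [dispersion, e1]
  ext z
  rw [Pi.neg_apply, Real.fourierInv_eq, Real.fourier_eq, ← integral_neg,
    ← integral_neg_eq_self]
  refine integral_congr_ae (.of_forall fun ζ => ?_)
  simp [inner_neg_left]

end BO2

namespace BO2

/-! ### The equation for a dyadic block -/

variable (P : DyadicPartition) (j : ℕ)

/-- The product of the symbol of `Δ_λ`, `λ = 2 ^ j`, and the inverse transform of `θ`. -/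
def testSymbol (θ : 𝓢(Plane, ℂ)) : 𝓢(Plane, ℂ) :=
  SchwartzMap.smulLeftCLM ℂ (P.blockSymbol j) (𝓕⁻ θ)

theorem testSymbol_apply (θ : 𝓢(Plane, ℂ)) (ζ : Plane) :
    testSymbol P j θ ζ = P.blockSymbol j ζ * (𝓕⁻ θ) ζ := by
  rw [testSymbol, SchwartzMap.smulLeftCLM_apply_apply (P.blockSymbol j).hasTemperateGrowth,
    smul_eq_mul]

theorem integral_mult_mul {m : Plane → ℂ} (hm : MemLp m ⊤) (f : L2C) (θ : 𝓢(Plane, ℂ)) :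
    ∫ z, mult m hm f z * θ z = ∫ ζ, (𝓕 f : L2C) ζ * (m ζ * (𝓕⁻ θ) ζ) := by
  rw [mult, integral_fourierInv_mul_schwartz]
  refine integral_congr_ae ?_
  filter_upwards [Lp.coeFn_lpSMul (r := 2) (hm.toLp m) (𝓕 f : L2C), hm.coeFn_toLp] with ζ h1 h2
  rw [h1, Pi.smul_apply', h2, smul_eq_mul]
  ring

/-- The transposed block maps `θ` to `𝓕 (testSymbol P j θ)`. This is again a Schwartz function,
hence admissible in the weak equation. -/
theorem integral_block_mul (f : L2C) (θ : 𝓢(Plane, ℂ)) :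
    ∫ z, P.block j f z * θ z = ∫ z, f z * (𝓕 (testSymbol P j θ)) z := by
  rw [P.block_eq_mult, integral_mult_mul, ← integral_fourier_mul_schwartz]
  simp_rw [testSymbol_apply]

/-- The dispersive term `Δ_λ (D_x^α ∂ₓ + 𝓗 ∂_y²) f`. -/
def linearL2 {α : ℝ} (hα : 0 < α) (f : L2C) : L2C := mult _ (memLp_dispersion_blockSymbol P j hα) f

theorem fourier_integral_ae_eq {F : Plane → ℂ} (hF : MemLp F 2) (hFi : Integrable F) :
    ((𝓕 (hF.toLp F) : L2C) : Plane → ℂ) =ᵐ[volume] 𝓕 F := by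
  refine (fourier_toLp_ae_eq _ (hFi.congr hF.coeFn_toLp.symm)).trans (.of_forall fun z => ?_)
  exact Real.fourier_congr_ae hF.coeFn_toLp z

/-- The dispersive symbol need not be smooth, so the image of the test function is only treated as
an element of `L²`. Its transform is a bounded symbol times a Schwartz function: integrability
identifies it with the pointwise integral, square integrability allows the pairing with `f`. -/
theorem dispersion_test {α : ℝ} (hα : 0 < α) (θ : 𝓢(Plane, ℂ)) :
    ∃ D : L2C, (D : Plane → ℂ) =ᵐ[volume] dispersion α (𝓕 (testSymbol P j θ)) ∧
      ∀ f : L2C, ∫ z, f z * D z = -∫ z, linearL2 P j hα f z * θ z := by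
  set F : Plane → ℂ := fun ζ => dispersionSymbol α ((2 * Real.pi) • ζ) * testSymbol P j θ ζ with hF
  have hℓ := memLp_dispersion_blockSymbol P j hα
  have e : F = fun ζ => (dispersionSymbol α ((2 * Real.pi) • ζ) * P.blockSymbol j ζ) *
      (𝓕⁻ θ) ζ := by
    ext ζ
    simp only [hF, testSymbol_apply]
    ring
  have hF2 : MemLp F 2 := by
    rw [e]
    exact ((𝓕⁻ θ : 𝓢(Plane, ℂ)).memLp 2 volume).mul hℓ
  have hFi : Integrable F := by
    rw [e, ← memLp_one_iff_integrable]
    exact ((𝓕⁻ θ : 𝓢(Plane, ℂ)).memLp 1 volume).mul hℓ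
  refine ⟨-(𝓕 (hF2.toLp F) : L2C), ?_, fun f => ?_⟩
  · filter_upwards [Lp.coeFn_neg (𝓕 (hF2.toLp F) : L2C), fourier_integral_ae_eq hF2 hFi]
      with z h1 h2
    rw [h1, Pi.neg_apply, h2, dispersion_fourier, Pi.neg_apply]
  · have h1 : ∫ z, f z * (-(𝓕 (hF2.toLp F) : L2C) : L2C) z = -pair f (𝓕 (hF2.toLp F) : L2C) := by
      rw [pair, ← integral_neg]
      refine integral_congr_ae ?_
      filter_upwards [Lp.coeFn_neg (𝓕 (hF2.toLp F) : L2C)] with z hz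
      rw [hz, Pi.neg_apply, mul_neg]
    rw [h1, ← pair_fourier, linearL2, integral_mult_mul, pair]
    congr 1
    refine integral_congr_ae ?_
    filter_upwards [hF2.coeFn_toLp] with ζ hζ
    rw [hζ, e]

/-- Since `f²` is only known to be integrable, Plancherel is not available; the derivative of the
test function is written with the block kernel and Fubini exchanges the integrals. -/
theorem integral_sq_mul_lineDeriv_test (f : L2C) (θ : 𝓢(Plane, ℂ)) :
    ∫ z, (1 / 2) * f z ^ 2 * (∂_{e 0} (𝓕 (testSymbol P j θ))) z =
      -∫ z, nonlinearL2 P j f z * θ z := by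
  set k : 𝓢(Plane, ℂ) := 𝓕⁻ (dx (P.blockSymbol j)) with hk
  have hf2 := (integrable_mul_L2C f f).congr (.of_forall fun z => (sq (f z)).symm)
  have h1 (y : Plane) : (∂_{e 0} (𝓕 (testSymbol P j θ))) y = -∫ z, k (z - y) * θ z := by
    have : ∂_{e 0} (𝓕 (testSymbol P j θ)) = -𝓕 (dx (testSymbol P j θ)) := by
      rw [SchwartzMap.lineDerivOp_fourier_eq, neg_smul]
      exact (SchwartzMap.fourierTransformCLM ℂ).map_neg _
    rw [this]
    change -((𝓕 (dx (testSymbol P j θ))) y) = _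
    rw [integral_reflect_mul (dx (P.blockSymbol j)) θ fun ζ => ?_]
    rw [dx_apply, dx_apply, testSymbol_apply]
    ring
  have hint : Integrable (Function.uncurry fun y z : Plane =>
      k (z - y) * ((1 / 2) * f y ^ 2 * θ z)) (volume.prod volume) := by
    refine ((hf2.const_mul (1 / 2)).mul_prod θ.integrable).bdd_mul
      (f := fun p : Plane × Plane => k (p.2 - p.1)) (c := ‖k.toBoundedContinuousFunction‖)
      ?_ (.of_forall fun p => k.toBoundedContinuousFunction.norm_coe_le_norm _)
    exact (k.continuous.comp (by fun_prop : Continuous fun p : Plane × Plane =>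
      p.2 - p.1)).aestronglyMeasurable
  calc _ = -∫ y, ∫ z, k (z - y) * ((1 / 2) * f y ^ 2 * θ z) := by
        rw [← integral_neg]
        congr 1 with y
        rw [h1, mul_neg, ← integral_const_mul]
        congr 2 with z
        ring
    _ = -∫ z, ∫ y, k (z - y) * ((1 / 2) * f y ^ 2 * θ z) := by rw [integral_integral_swap hint]
    _ = _ := by
        congr 1
        refine integral_congr_ae ?_
        filter_upwards [(memLp_nonlinear P j f).coeFn_toLp] with z hz
        rw [nonlinearL2, hz, nonlinear, conv, ← integral_const_mul, ← integral_mul_const]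
        congr 1 with y
        ring

theorem continuous_toComplex : Continuous toComplex :=
  (Complex.ofRealCLM.compLpL 2 (volume : Measure Plane)).continuous

/-- The time derivative of the dyadic block. -/
def blockRHS {α : ℝ} (hα : 0 < α) (f : L2R) : L2C :=
  -(linearL2 P j hα (toComplex f) + nonlinearL2 P j (toComplex f))

theorem continuous_blockRHS {α : ℝ} (hα : 0 < α) : Continuous (blockRHS P j hα) :=
  (((continuous_mult _ _).comp continuous_toComplex).add
    ((continuous_nonlinearL2 P j).comp continuous_toComplex)).neg

theorem integrable_L2C_mul_schwartz (f : L2C) (θ : 𝓢(Plane, ℂ)) :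
    Integrable fun z => f z * θ z :=
  (Lp.memLp f).integrable_mul (θ.memLp 2 volume)

theorem weakRHS_test {α : ℝ} (hα : 0 < α) (f : L2R) (θ : 𝓢(Plane, ℂ)) :
    weakRHS α f (𝓕 (testSymbol P j θ)) = ∫ z, blockRHS P j hα f z * θ z := by
  obtain ⟨D, hD, hDf⟩ := dispersion_test P j hα θ
  set ψ := 𝓕 (testSymbol P j θ) with hψ
  set g := toComplex f with hg
  have hi1 : Integrable fun z => g z * D z := integrable_mul_L2C g D
  have hi2 : Integrable fun z => (1 / 2) * g z ^ 2 * (∂_{e 0} ψ) z := by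
    have hf2 := (integrable_mul_L2C g g).congr (.of_forall fun z => (sq (g z)).symm)
    refine (hf2.const_mul (1 / 2)).mul_bdd (c := ‖(∂_{e 0} ψ).toBoundedContinuousFunction‖)
      (∂_{e 0} ψ).continuous.aestronglyMeasurable
      (.of_forall fun z => (∂_{e 0} ψ).toBoundedContinuousFunction.norm_coe_le_norm z)
  have e1 : weakRHS α f ψ = ∫ z, (g z * D z + (1 / 2) * g z ^ 2 * (∂_{e 0} ψ) z) := by
    refine integral_congr_ae ?_
    filter_upwards [toComplex_ae_eq f, hD] with z h1 h2
    rw [hg, h1, h2]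
  rw [e1, integral_add hi1 hi2, hDf, integral_sq_mul_lineDeriv_test, ← neg_add,
    ← integral_add (integrable_L2C_mul_schwartz _ θ) (integrable_L2C_mul_schwartz _ θ),
    ← integral_neg]
  refine integral_congr_ae ?_
  filter_upwards [Lp.coeFn_neg (linearL2 P j hα g + nonlinearL2 P j g),
    Lp.coeFn_add (linearL2 P j hα g) (nonlinearL2 P j g)] with z h1 h2
  rw [blockRHS, h1, Pi.neg_apply, h2, Pi.add_apply]
  ring

/-- Integration against a Schwartz function as a continuous functional on `L²`. -/
theorem exists_pairing_clm (θ : 𝓢(Plane, ℂ)) :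
    ∃ ℓ : L2C →L[ℂ] ℂ, ∀ f : L2C, ℓ f = ∫ z, f z * θ z := by
  refine ⟨innerSL ℂ (star (θ.toLp 2 volume)), fun f => ?_⟩
  rw [innerSL_apply_apply, ← pair_eq_inner]
  refine integral_congr_ae ?_
  filter_upwards [θ.coeFn_toLp 2 volume] with z hz
  rw [hz, mul_comm]

variable {α s T : ℝ} {u : ℝ → L2R} {U : ℝ → Jet}

/-- The weak equation is tested with transposed blocks of Schwartz functions, which determine an
element of `L²`. The integrand is continuous in `L²`, so the time integral commutes with the
pairing. -/
theorem IsSolution.block_eq (hu : IsSolution α s T u U) (hα : 0 < α)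
    (huc : ContinuousOn u (Icc 0 T)) {t : ℝ} (ht : t ∈ Icc 0 T) :
    P.block j (toComplex (u t)) =
      P.block j (toComplex (u 0)) + ∫ r in (0 : ℝ)..t, blockRHS P j hα (u r) := by
  have hsub : uIcc 0 t ⊆ Icc 0 T := by
    rw [uIcc_of_le ht.1]
    exact Icc_subset_Icc_right ht.2
  have hGi : IntervalIntegrable (fun r => blockRHS P j hα (u r)) volume 0 t :=
    ((continuous_blockRHS P j hα).comp_continuousOn (huc.mono hsub)).intervalIntegrable
  refine eq_of_pair_schwartz fun θ => ?_
  obtain ⟨ℓ, hℓ⟩ := exists_pairing_clm θ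
  rw [← hℓ, ← hℓ, map_add, ← ContinuousLinearMap.intervalIntegral_comp_comm _ hGi, hℓ, hℓ,
    integral_block_mul, integral_block_mul]
  have h := hu.weak_eq (𝓕 (testSymbol P j θ)) t ht
  have e (f : L2R) : ∫ z, toComplex f z * (𝓕 (testSymbol P j θ)) z =
      ∫ z, (f z : ℂ) * (𝓕 (testSymbol P j θ)) z := by
    refine integral_congr_ae ?_
    filter_upwards [toComplex_ae_eq f] with z hz
    rw [hz]
  rw [e, e]
  simp_rw [weakRHS_test P j hα] at h
  simp_rw [hℓ]
  linear_combination h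

end BO2

namespace BO2

/-! ### The energy identity for a dyadic block -/

variable (P : DyadicPartition) (j : ℕ)

/-- By Plancherel, the integrand is a nonnegative real function times the purely imaginary
dispersive symbol. -/
theorem re_inner_linearL2 {α : ℝ} (hα : 0 < α) (f : L2C) :
    (inner ℂ (P.block j f) (linearL2 P j hα f)).re = 0 := by
  rw [← Lp.inner_fourier_eq, L2.inner_def]
  have hint := L2.integrable_inner (𝕜 := ℂ) (𝓕 (P.block j f) : L2C) (𝓕 (linearL2 P j hα f) : L2C)
  rw [← Complex.reCLM_apply, ← Complex.reCLM.integral_comp_comm hint]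
  refine integral_eq_zero_of_ae ?_
  filter_upwards [fourier_mult_ae_eq _ (P.memLp_blockSymbol j) f,
    fourier_mult_ae_eq _ (memLp_dispersion_blockSymbol P j hα) f] with ζ h1 h2
  rw [P.block_eq_mult, linearL2, h1, h2, Complex.reCLM_apply, RCLike.inner_apply]
  set a := P.blockSymbol j ζ * (𝓕 f : L2C) ζ with ha
  rw [show dispersionSymbol α ((2 * Real.pi) • ζ) * P.blockSymbol j ζ * (𝓕 f : L2C) ζ *
      (starRingEnd ℂ) a = dispersionSymbol α ((2 * Real.pi) • ζ) * (a * (starRingEnd ℂ) a) by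
    rw [ha]; ring, Complex.mul_conj, mul_comm, Complex.re_ofReal_mul, dispersionSymbol_re, mul_zero]
  rfl

theorem re_inner_nonlinearL2 (f : L2C) :
    (inner ℂ (P.block j f) (nonlinearL2 P j f)).re =
      ∫ z, ((starRingEnd ℂ) (P.block j f z) * nonlinear P j f z).re := by
  rw [L2.inner_def]
  have hint := L2.integrable_inner (𝕜 := ℂ) (P.block j f) (nonlinearL2 P j f)
  rw [← Complex.reCLM_apply, ← Complex.reCLM.integral_comp_comm hint]
  refine integral_congr_ae ?_
  filter_upwards [(memLp_nonlinear P j f).coeFn_toLp] with z hz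
  rw [nonlinearL2, hz, Complex.reCLM_apply, RCLike.inner_apply, mul_comm]

variable {α s T : ℝ} {u : ℝ → L2R} {U : ℝ → Jet}

theorem continuous_block : Continuous (P.block j) :=
  continuous_mult _ (P.memLp_blockSymbol j)

theorem IsSolution.hasDerivAt_block (hu : IsSolution α s T u U) (hα : 0 < α)
    (huc : ContinuousOn u (Icc 0 T)) {t : ℝ} (ht : t ∈ Ioo 0 T) :
    HasDerivAt (fun r => P.block j (toComplex (u r))) (blockRHS P j hα (u t)) t := by
  have hGc : ContinuousOn (fun r => blockRHS P j hα (u r)) (Icc 0 T) :=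
    (continuous_blockRHS P j hα).comp_continuousOn huc
  have hn : Icc 0 T ∈ nhds t := Icc_mem_nhds ht.1 ht.2
  have h1 : HasDerivAt (fun t => ∫ r in (0 : ℝ)..t, blockRHS P j hα (u r))
      (blockRHS P j hα (u t)) t := by
    refine intervalIntegral.integral_hasDerivAt_right ?_ ?_ (hGc.continuousAt hn)
    · refine (hGc.mono ?_).intervalIntegrable
      rw [uIcc_of_le ht.1.le]
      exact Icc_subset_Icc_right ht.2.le
    · exact ⟨Icc 0 T, hn, hGc.aestronglyMeasurable measurableSet_Icc⟩
  refine (h1.const_add (P.block j (toComplex (u 0)))).congr_of_eventuallyEq ?_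
  filter_upwards [hn] with r hr
  exact hu.block_eq P j hα huc hr

theorem IsSolution.norm_block_sq_sub (hu : IsSolution α s T u U) (hα : 0 < α)
    (huc : ContinuousOn u (Icc 0 T)) {a b : ℝ} (ha : a ∈ Icc 0 T) (hb : b ∈ Icc 0 T) :
    ‖P.block j (toComplex (u b))‖ ^ 2 - ‖P.block j (toComplex (u a))‖ ^ 2 =
      ∫ r in a..b, -2 * ∫ z, ((starRingEnd ℂ) (P.block j (toComplex (u r)) z) *
        nonlinear P j (toComplex (u r)) z).re := by
  -- Both sides change sign when `a` and `b` are exchanged.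
  wlog hab : a ≤ b generalizing a b
  · rw [intervalIntegral.integral_symm, ← this hb ha (le_of_not_ge hab)]
    ring
  have hsub : Icc a b ⊆ Icc 0 T := Icc_subset_Icc ha.1 hb.2
  have hVc : ContinuousOn (fun r => P.block j (toComplex (u r))) (Icc a b) :=
    ((continuous_block P j).comp continuous_toComplex).comp_continuousOn (huc.mono hsub)
  have hNc : ContinuousOn (fun r => nonlinearL2 P j (toComplex (u r))) (Icc a b) :=
    ((continuous_nonlinearL2 P j).comp continuous_toComplex).comp_continuousOn (huc.mono hsub)
  simp_rw [← re_inner_nonlinearL2]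
  symm
  refine intervalIntegral.integral_eq_sub_of_hasDeriv_right_of_le hab (hVc.norm.pow 2)
    (fun r hr => ?_) ?_
  · have hd := hu.hasDerivAt_block P j hα huc (t := r)
      ⟨ha.1.trans_lt hr.1, hr.2.trans_le hb.2⟩
    have h2 := hd.norm_sq
    have e : 2 * inner ℝ (P.block j (toComplex (u r))) (blockRHS P j hα (u r)) =
        -2 * (inner ℂ (P.block j (toComplex (u r))) (nonlinearL2 P j (toComplex (u r)))).re := by
      have h3 : inner ℝ (P.block j (toComplex (u r))) (blockRHS P j hα (u r)) =
          (inner ℂ (P.block j (toComplex (u r))) (blockRHS P j hα (u r))).re := by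
        rw [L2.inner_def, L2.inner_def, ← Complex.reCLM_apply,
          ← Complex.reCLM.integral_comp_comm (L2.integrable_inner _ _)]
        rfl
      rw [h3, blockRHS, inner_neg_right, inner_add_right, Complex.neg_re, Complex.add_re,
        re_inner_linearL2]
      ring
    rw [e] at h2
    exact h2.hasDerivWithinAt
  · refine ContinuousOn.intervalIntegrable ?_
    rw [uIcc_of_le hab]
    exact continuousOn_const.mul (Complex.continuous_re.comp_continuousOn (hVc.inner hNc))

/-- With the absolute value of the flux under the integral, the inequality holds in both time
directions; the final estimate for arbitrary `τ` and `t` rests on this. -/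
theorem IsSolution.enorm_block_sq_le (hu : IsSolution α s T u U) (hα : 0 < α)
    (huc : ContinuousOn u (Icc 0 T)) {a b : ℝ} (ha : a ∈ Icc 0 T) (hb : b ∈ Icc 0 T) :
    ‖P.block j (toComplex (u b))‖ₑ ^ 2 ≤ ‖P.block j (toComplex (u a))‖ₑ ^ 2 +
      ∫⁻ r in uIcc a b, 2 * ‖∫ z, ((starRingEnd ℂ) (P.block j (toComplex (u r)) z) *
        nonlinear P j (toComplex (u r)) z).re‖ₑ := by
  have h := hu.norm_block_sq_sub P j hα huc ha hb
  set I : ℝ → ℝ := fun r => ∫ z, ((starRingEnd ℂ) (P.block j (toComplex (u r)) z) *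
        nonlinear P j (toComplex (u r)) z).re with hI
  have e : ‖P.block j (toComplex (u b))‖ ^ 2 =
      ‖P.block j (toComplex (u a))‖ ^ 2 + ∫ r in a..b, -2 * I r := by
    linear_combination h
  have h1 : ‖∫ r in a..b, -2 * I r‖ₑ ≤ ∫⁻ r in uIcc a b, 2 * ‖I r‖ₑ := by
    rw [← ofReal_norm, intervalIntegral.norm_intervalIntegral_eq, ofReal_norm]
    refine (enorm_integral_le_lintegral_enorm _).trans ?_
    refine (lintegral_mono_set uIoc_subset_uIcc).trans (le_of_eq ?_)
    refine lintegral_congr fun r => ?_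
    rw [enorm_mul]
    congr 1
    simp [← ofReal_norm]
  calc ‖P.block j (toComplex (u b))‖ₑ ^ 2 = ENNReal.ofReal (‖P.block j (toComplex (u b))‖ ^ 2) := by
        rw [ENNReal.ofReal_pow (norm_nonneg _), ofReal_norm]
    _ ≤ ENNReal.ofReal (‖P.block j (toComplex (u a))‖ ^ 2) + ‖∫ r in a..b, -2 * I r‖ₑ := by
        rw [e, ← ofReal_norm]
        exact ENNReal.ofReal_add_le.trans (by gcongr; exact le_abs_self _)
    _ ≤ _ := by
        rw [ENNReal.ofReal_pow (norm_nonneg _), ofReal_norm]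
        gcongr

end BO2

namespace BO2

/-! ### Consequences of `H^s` regularity -/

theorem fourier_ae_eq_of_besselPotential {s : ℝ} {f v : L2C}
    (h : TemperedDistribution.besselPotential Plane ℂ s (f : 𝓢'(Plane, ℂ)) = (v : 𝓢'(Plane, ℂ))) :
    ((𝓕 v : L2C) : Plane → ℂ) =ᵐ[volume]
      fun ζ => (((1 + ‖ζ‖ ^ 2) ^ (s / 2) : ℝ) : ℂ) * (𝓕 f : L2C) ζ := by
  set g : Plane → ℂ := fun ζ => (((1 + ‖ζ‖ ^ 2) ^ (s / 2) : ℝ) : ℂ) with hg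
  have hgt : g.HasTemperateGrowth := by fun_prop
  have h1 := congrArg (𝓕 ·) h
  simp only [TemperedDistribution.fourier_besselPotential_eq_smulLeftCLM_fourier_apply,
    Lp.fourier_toTemperedDistribution_eq] at h1
  refine ae_eq_of_integral_mul_schwartz_eq ((Lp.memLp _).locallyIntegrable (by norm_num))
    ?_ fun ψ => ?_
  · rw [locallyIntegrable_iff]
    intro K hK
    exact ((((Lp.memLp (𝓕 f : L2C)).locallyIntegrable (by norm_num)).integrableOn_isCompact
      hK)).continuousOn_mul hgt.1.continuous.continuousOn hK
  · have h2 := DFunLike.congr_fun h1 ψ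
    rw [TemperedDistribution.smulLeftCLM_apply_apply, Lp.toTemperedDistribution_apply,
      Lp.toTemperedDistribution_apply] at h2
    change ∫ x, (SchwartzMap.smulLeftCLM ℂ g ψ) x • (𝓕 f : L2C) x = _ at h2
    simp only [SchwartzMap.smulLeftCLM_apply_apply hgt, smul_eq_mul] at h2
    simp_rw [mul_comm _ (ψ _), ← h2]
    congr 1 with ζ
    ring

theorem one_le_bessel {s : ℝ} (hs : 0 ≤ s) (ζ : Plane) : 1 ≤ (1 + ‖ζ‖ ^ 2) ^ (s / 2) :=
  Real.one_le_rpow (by nlinarith [sq_nonneg ‖ζ‖]) (by positivity)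

theorem norm_le_of_besselPotential {s : ℝ} (hs : 0 ≤ s) {f v : L2C}
    (h : TemperedDistribution.besselPotential Plane ℂ s (f : 𝓢'(Plane, ℂ)) = (v : 𝓢'(Plane, ℂ))) :
    ‖f‖ ≤ ‖v‖ := by
  rw [← Lp.norm_fourier_eq f, ← Lp.norm_fourier_eq v]
  refine Lp.norm_le_norm_of_ae_le ?_
  filter_upwards [fourier_ae_eq_of_besselPotential h] with ζ hζ
  have := one_le_bessel hs ζ
  rw [hζ, norm_mul, Complex.norm_real, Real.norm_eq_abs, abs_of_nonneg (by positivity)]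
  exact le_mul_of_one_le_left (norm_nonneg _) this

theorem norm_toComplex_sub (f g : L2R) : ‖toComplex f - toComplex g‖ = ‖f - g‖ := by
  rw [Lp.norm_def, Lp.norm_def]
  congr 1
  refine eLpNorm_congr_norm_ae ?_
  filter_upwards [Lp.coeFn_sub f g, Lp.coeFn_sub (toComplex f) (toComplex g), toComplex_ae_eq f,
    toComplex_ae_eq g] with z h1 h2 h3 h4
  rw [h1, h2, Pi.sub_apply, Pi.sub_apply, h3, h4, ← Complex.ofReal_sub, Complex.norm_real]

/-- For `s ≥ 0` the Bessel symbol is at least `1`, so the `L²` norm of a difference is bounded by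
its `H^s` norm. -/
theorem ContinuousInHs.continuousOn {s T : ℝ} {u : ℝ → L2R} (hs : 0 ≤ s)
    (h : ContinuousInHs s T u) : ContinuousOn u (Icc 0 T) := by
  obtain ⟨v, hv, huv⟩ := h
  intro t ht
  have hvt := hv t ht
  rw [ContinuousWithinAt, tendsto_iff_norm_sub_tendsto_zero] at hvt ⊢
  refine squeeze_zero' (.of_forall fun r => norm_nonneg _) ?_ hvt
  filter_upwards [self_mem_nhdsWithin] with r hr
  rw [← norm_toComplex_sub]
  refine norm_le_of_besselPotential hs ?_
  have e (f g : L2C) : ((f - g : L2C) : 𝓢'(Plane, ℂ)) = (f : 𝓢'(Plane, ℂ)) - (g : 𝓢'(Plane, ℂ)) :=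
    (Lp.toTemperedDistributionCLM ℂ (volume : Measure Plane) 2).map_sub f g
  rw [e, e, map_sub, huv r hr, huv t ht]

theorem DyadicPartition.exists_symbol_bound (P : DyadicPartition) :
    ∃ M : ℝ, 0 ≤ M ∧ ∀ j ζ, |P.symbol j ζ| ≤ M := by
  obtain ⟨M, hM⟩ := (DyadicPartition.hasCompactSupport_of_subset
    (P.tsupport_φ.trans fun ζ hζ => hζ.2)).exists_bound_of_continuous P.contDiff_φ.continuous
  obtain ⟨M', hM'⟩ := (DyadicPartition.hasCompactSupport_of_subset
    P.tsupport_χ).exists_bound_of_continuous P.contDiff_χ.continuous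
  refine ⟨max M M', le_max_of_le_left ((norm_nonneg _).trans (hM 0)), fun j ζ => ?_⟩
  unfold DyadicPartition.symbol
  split_ifs
  · exact le_max_of_le_right (hM' _)
  · exact le_max_of_le_left (hM _)

/-- On the support of the block `j ≥ 1`, the squared Bessel symbol is at least `‖ζ‖ ^ 3` because `s
≥ 3 / 2`, and this is at least a constant times `8 ^ j`. -/
theorem DyadicPartition.exists_enorm_block_sq_le (P : DyadicPartition) :
    ∃ c : ℝ, 0 ≤ c ∧ ∀ (s : ℝ) (f v : L2C), 3 / 2 ≤ s →
      TemperedDistribution.besselPotential Plane ℂ s (f : 𝓢'(Plane, ℂ)) = (v : 𝓢'(Plane, ℂ)) →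
      ∀ j, ‖P.block j f‖ₑ ^ 2 ≤ ENNReal.ofReal (c * (1 / 8) ^ j) * ‖v‖ₑ ^ 2 := by
  obtain ⟨M, hM0, hM⟩ := P.exists_symbol_bound
  -- `2 ^ 12 = 8 * 8 ^ 3`: the cube comes from `2 ^ j ≤ 2π ‖ζ‖ ≤ 8 ‖ζ‖` on the support of the block
  -- `j + 1`, the other `8` from the index shift.
  refine ⟨M ^ 2 * 2 ^ 12, by positivity, fun s f v hs h j => ?_⟩
  have hsymb (ζ : Plane) : ‖P.blockSymbol j ζ‖ ^ 2 ≤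
      M ^ 2 * 2 ^ 12 * (1 / 8) ^ j * ((1 + ‖ζ‖ ^ 2) ^ (s / 2)) ^ 2 := by
    by_cases h0 : P.symbol j ((2 * Real.pi) • ζ) = 0
    · rw [P.blockSymbol_apply, h0]
      rw [Complex.ofReal_zero, norm_zero, zero_pow two_ne_zero]
      exact mul_nonneg (by positivity) (sq_nonneg _)
    have h1 : ‖P.blockSymbol j ζ‖ ^ 2 ≤ M ^ 2 := by
      rw [P.blockSymbol_apply, Complex.norm_real, Real.norm_eq_abs]
      exact pow_le_pow_left₀ (abs_nonneg _) (hM _ _) 2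
    have hb := one_le_bessel (by linarith : 0 ≤ s) ζ
    have h2 : 1 ≤ 2 ^ 12 * (1 / 8 : ℝ) ^ j * ((1 + ‖ζ‖ ^ 2) ^ (s / 2)) ^ 2 := by
      rcases j with _ | j
      · nlinarith
      have h3 := P.lt_norm_of_symbol_ne_zero h0
      rw [norm_smul, Real.norm_eq_abs, abs_of_pos Real.two_pi_pos] at h3
      have h4 : (2 : ℝ) ^ j ≤ 8 * ‖ζ‖ := by
        have := Real.pi_lt_four
        nlinarith [norm_nonneg ζ]
      have h5 : ‖ζ‖ ^ 3 ≤ ((1 + ‖ζ‖ ^ 2) ^ (s / 2)) ^ 2 := by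
        have e1 : ‖ζ‖ ≤ (1 + ‖ζ‖ ^ 2) ^ (1 / 2 : ℝ) := by
          rw [← Real.sqrt_eq_rpow]
          exact Real.le_sqrt_of_sq_le (by linarith)
        calc ‖ζ‖ ^ 3 ≤ ((1 + ‖ζ‖ ^ 2) ^ (1 / 2 : ℝ)) ^ 3 := by gcongr
          _ = (1 + ‖ζ‖ ^ 2) ^ (3 / 2 : ℝ) := by
              rw [← Real.rpow_natCast, ← Real.rpow_mul (by positivity)]
              norm_num
          _ ≤ (1 + ‖ζ‖ ^ 2) ^ s :=
              Real.rpow_le_rpow_of_exponent_le (by nlinarith [sq_nonneg ‖ζ‖]) hs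
          _ = _ := by
              rw [← Real.rpow_mul_natCast (by positivity)]
              congr 1
              push_cast
              ring
      have h6 : (8 : ℝ) ^ j ≤ 512 * ‖ζ‖ ^ 3 := by
        calc (8 : ℝ) ^ j = (2 ^ j) ^ 3 := by rw [← pow_mul, mul_comm, pow_mul]; norm_num
          _ ≤ (8 * ‖ζ‖) ^ 3 := by gcongr
          _ = _ := by ring
      have h7 : (1 / 8 : ℝ) ^ (j + 1) * 8 ^ j = 1 / 8 := by
        rw [pow_succ, mul_right_comm, ← mul_pow]
        norm_num
      have h8 : (0 : ℝ) < (1 / 8) ^ (j + 1) := by positivity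
      calc (1 : ℝ) = 8 * ((1 / 8 : ℝ) ^ (j + 1) * 8 ^ j) := by rw [h7]; norm_num
        _ ≤ 8 * ((1 / 8 : ℝ) ^ (j + 1) * (512 * ((1 + ‖ζ‖ ^ 2) ^ (s / 2)) ^ 2)) := by
            gcongr
            exact h6.trans (by gcongr)
        _ = _ := by ring
    calc _ ≤ M ^ 2 * 1 := by rwa [mul_one]
      _ ≤ M ^ 2 * (2 ^ 12 * (1 / 8 : ℝ) ^ j * ((1 + ‖ζ‖ ^ 2) ^ (s / 2)) ^ 2) := by gcongr
      _ = _ := by ring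
  rw [P.block_eq_mult, enorm_mult_sq, ← ofReal_norm (x := v), ← Lp.norm_fourier_eq v, ofReal_norm,
    enorm_sq_eq_lintegral, ← lintegral_const_mul' _ _ ENNReal.ofReal_ne_top]
  refine lintegral_mono_ae ?_
  filter_upwards [fourier_ae_eq_of_besselPotential h] with ζ hζ
  rw [hζ, enorm_mul, mul_pow, ← mul_assoc]
  gcongr
  rw [← ofReal_norm, ← ofReal_norm, ← ENNReal.ofReal_pow (norm_nonneg _),
    ← ENNReal.ofReal_pow (norm_nonneg _), ← ENNReal.ofReal_mul (by positivity)]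
  refine ENNReal.ofReal_le_ofReal ((hsymb ζ).trans (le_of_eq ?_))
  rw [Complex.norm_real, Real.norm_eq_abs, sq_abs]

end BO2

namespace BO2

/-! ### A Gronwall inequality -/

theorem lintegral_uIcc_ofReal {T : ℝ} {A : ℝ → ℝ} (hA : IntegrableOn A (Icc 0 T))
    (hA0 : ∀ r, 0 ≤ A r) {a b : ℝ} (ha : a ∈ Icc 0 T) (hb : b ∈ Icc 0 T) :
    ∫⁻ r in uIcc a b, ENNReal.ofReal (A r) = ENNReal.ofReal |∫ r in a..b, A r| := by
  have hs : uIcc a b ⊆ Icc 0 T := uIcc_subset_Icc ha hb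
  rw [← ofReal_integral_eq_lintegral_ofReal (hA.mono_set hs) (.of_forall hA0),
    intervalIntegral.abs_integral_eq_abs_integral_uIoc,
    abs_of_nonneg (integral_nonneg fun r => hA0 r), uIcc, uIoc, integral_Icc_eq_integral_Ioc]

/-- The supremum `M` of `E` between `a` and `b` satisfies `M ≤ E a + M / 2`, and it is finite by the
a priori bound, so half of it is absorbed. Neither continuity nor measurability of `E` is needed. -/
theorem gronwall_of_integral_le_half {T : ℝ} {A : ℝ → ℝ} {E : ℝ → ℝ≥0∞} {B : ℝ≥0∞} (hB : B ≠ ⊤)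
    (hE : ∀ t ∈ Icc 0 T, E t ≤ B) (hA : IntegrableOn A (Icc 0 T)) (hA0 : ∀ r, 0 ≤ A r)
    (h : ∀ a ∈ Icc 0 T, ∀ b ∈ Icc 0 T,
      E b ≤ E a + ∫⁻ r in uIcc a b, ENNReal.ofReal (A r) * E r)
    {a b : ℝ} (ha : a ∈ Icc 0 T) (hb : b ∈ Icc 0 T) (hab : |∫ r in a..b, A r| ≤ 1 / 2) :
    E b ≤ 2 * E a := by
  have hs : uIcc a b ⊆ Icc 0 T := uIcc_subset_Icc ha hb
  set M : ℝ≥0∞ := ⨆ r ∈ uIcc a b, E r with hM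
  have hMt : M ≠ ⊤ := ne_top_of_le_ne_top hB (iSup₂_le fun r hr => hE r (hs hr))
  have hM1 : M ≤ E a + 2⁻¹ * M := by
    refine iSup₂_le fun r hr => (h a ha r (hs hr)).trans ?_
    gcongr
    calc ∫⁻ q in uIcc a r, ENNReal.ofReal (A q) * E q
        ≤ ∫⁻ q in uIcc a r, ENNReal.ofReal (A q) * M :=
          setLIntegral_mono' measurableSet_uIcc fun q hq => by
            gcongr
            exact le_iSup₂_of_le q (uIcc_subset_uIcc_left hr hq) le_rfl
      _ = (∫⁻ q in uIcc a r, ENNReal.ofReal (A q)) * M := lintegral_mul_const' _ _ hMt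
      _ ≤ (∫⁻ q in uIcc a b, ENNReal.ofReal (A q)) * M := by
          gcongr
          exact uIcc_subset_uIcc_left hr
      _ ≤ 2⁻¹ * M := by
          gcongr
          rw [lintegral_uIcc_ofReal hA hA0 ha hb]
          refine (ENNReal.ofReal_le_ofReal hab).trans (le_of_eq ?_)
          rw [one_div, ENNReal.ofReal_inv_of_pos two_pos, ENNReal.ofReal_ofNat]
  have hM2 : M ≤ 2 * E a := by
    have h2 : 2⁻¹ * M ≠ ⊤ := ENNReal.mul_ne_top (by simp) hMt
    have h3 : 2⁻¹ * M ≤ E a := by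
      refine (ENNReal.add_le_add_iff_right h2).1 ?_
      rwa [← add_mul, ENNReal.inv_two_add_inv_two, one_mul]
    calc M = 2 * (2⁻¹ * M) := by
          rw [← mul_assoc, ENNReal.mul_inv_cancel (by simp) (by simp), one_mul]
      _ ≤ _ := by gcongr
  exact (le_iSup₂_of_le b right_mem_uIcc le_rfl).trans hM2

/-- The interval is cut into pieces on which `A` has integral at most `1/2`, each costing a factor
`2`. -/
theorem gronwall_of_integral_le_nat {T : ℝ} {A : ℝ → ℝ} {E : ℝ → ℝ≥0∞} {B : ℝ≥0∞} (hB : B ≠ ⊤)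
    (hE : ∀ t ∈ Icc 0 T, E t ≤ B) (hA : IntegrableOn A (Icc 0 T)) (hA0 : ∀ r, 0 ≤ A r)
    (h : ∀ a ∈ Icc 0 T, ∀ b ∈ Icc 0 T,
      E b ≤ E a + ∫⁻ r in uIcc a b, ENNReal.ofReal (A r) * E r) (n : ℕ) :
    ∀ {a b : ℝ}, a ∈ Icc 0 T → b ∈ Icc 0 T → |∫ r in a..b, A r| ≤ n / 2 →
      E b ≤ 2 ^ (n + 1) * E a := by
  induction n with
  | zero =>
    intro a b ha hb hab
    rw [zero_add, pow_one]
    refine gronwall_of_integral_le_half hB hE hA hA0 h ha hb (hab.trans ?_)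
    norm_num
  | succ n ih =>
    intro a b ha hb hab
    have hs : uIcc a b ⊆ Icc 0 T := uIcc_subset_Icc ha hb
    have hi {x y : ℝ} (hx : x ∈ Icc 0 T) (hy : y ∈ Icc 0 T) : IntervalIntegrable A volume x y :=
      (hA.mono_set (uIcc_subset_Icc hx hy)).intervalIntegrable
    have hc : ContinuousOn (fun x => ∫ r in a..x, A r) (uIcc a b) :=
      intervalIntegral.continuousOn_primitive_interval (hA.mono_set hs)
    set I := ∫ r in a..b, A r with hI
    -- The intermediate value theorem for the primitive of `A` gives a point `c` that splits off the
    -- fraction `1 / (n + 1)` of the integral; `b` may lie on either side of `a`.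
    have hmem : I / (n + 1) ∈ uIcc (∫ r in a..a, A r) (∫ r in a..b, A r) := by
      rw [intervalIntegral.integral_same, ← hI, mem_uIcc]
      have h1 : (1 : ℝ) ≤ n + 1 := by simp
      rcases le_total 0 I with h0 | h0
      · exact .inl ⟨by positivity, div_le_self h0 h1⟩
      · refine .inr ⟨?_, div_nonpos_of_nonpos_of_nonneg h0 (by positivity)⟩
        rw [le_div_iff₀ (by positivity)]
        nlinarith
    obtain ⟨c, hcm, hcI⟩ := intermediate_value_uIcc hc hmem
    have hcb : ∫ r in c..b, A r = n * (I / (n + 1)) := by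
      have := intervalIntegral.integral_add_adjacent_intervals (hi ha (hs hcm)) (hi (hs hcm) hb)
      simp only at hcI
      rw [hcI, ← hI] at this
      field_simp at this ⊢
      linarith
    have habs : |I / (n + 1)| ≤ 1 / 2 := by
      rw [abs_div, abs_of_pos (by positivity : (0 : ℝ) < n + 1), div_le_iff₀ (by positivity)]
      push_cast at hab
      linarith
    have h1 : E c ≤ 2 * E a := by
      refine gronwall_of_integral_le_half hB hE hA hA0 h ha (hs hcm) ?_
      simpa only [hcI] using habs
    have h2 : E b ≤ 2 ^ (n + 1) * E c := by
      refine ih (hs hcm) hb ?_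
      rw [hcb, abs_mul, Nat.abs_cast]
      exact (mul_le_mul_of_nonneg_left habs n.cast_nonneg).trans_eq (by ring)
    calc E b ≤ 2 ^ (n + 1) * (2 * E a) := h2.trans (by gcongr)
      _ = _ := by ring

theorem gronwall {T : ℝ} {A : ℝ → ℝ} {E : ℝ → ℝ≥0∞} {B : ℝ≥0∞} (hB : B ≠ ⊤)
    (hE : ∀ t ∈ Icc 0 T, E t ≤ B) (hA : IntegrableOn A (Icc 0 T)) (hA0 : ∀ r, 0 ≤ A r)
    (h : ∀ a ∈ Icc 0 T, ∀ b ∈ Icc 0 T,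
      E b ≤ E a + ∫⁻ r in uIcc a b, ENNReal.ofReal (A r) * E r)
    {a b : ℝ} (ha : a ∈ Icc 0 T) (hb : b ∈ Icc 0 T) :
    E b ≤ ENNReal.ofReal (4 * Real.exp (2 * ∫ r in uIcc a b, A r)) * E a := by
  have hI : |∫ r in a..b, A r| = ∫ r in uIcc a b, A r := by
    rw [intervalIntegral.abs_integral_eq_abs_integral_uIoc,
      abs_of_nonneg (integral_nonneg fun r => hA0 r), uIcc, uIoc, integral_Icc_eq_integral_Ioc]
  set x := ∫ r in uIcc a b, A r
  have hx : 0 ≤ x := hI ▸ abs_nonneg _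
  -- With `n = ⌈2x⌉` one has `n + 1 ≤ 2 + 2x`, hence `2 ^ (n + 1) ≤ 4 * 2 ^ (2x) ≤ 4 * exp (2x)`.
  refine (gronwall_of_integral_le_nat hB hE hA hA0 h ⌈2 * x⌉₊ ha hb ?_).trans ?_
  · rw [hI]
    linarith [Nat.le_ceil (2 * x)]
  · gcongr
    rw [show (2 : ℝ≥0∞) ^ (⌈2 * x⌉₊ + 1) = ENNReal.ofReal (2 ^ (⌈2 * x⌉₊ + 1)) by
      rw [ENNReal.ofReal_pow (by norm_num), ENNReal.ofReal_ofNat]]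
    refine ENNReal.ofReal_le_ofReal ?_
    have h2 : (2 : ℝ) ≤ Real.exp 1 := by linarith [Real.add_one_le_exp 1]
    have h3 : (⌈2 * x⌉₊ : ℝ) ≤ 2 * x + 1 := (Nat.ceil_lt_add_one (by positivity)).le
    calc (2 : ℝ) ^ (⌈2 * x⌉₊ + 1) = 2 ^ ((⌈2 * x⌉₊ + 1 : ℕ) : ℝ) := (Real.rpow_natCast _ _).symm
      _ ≤ 2 ^ (2 + 2 * x) :=
          Real.rpow_le_rpow_of_exponent_le one_le_two (by push_cast; linarith)
      _ = 4 * 2 ^ (2 * x) := by rw [Real.rpow_add two_pos]; norm_num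
      _ ≤ 4 * Real.exp 1 ^ (2 * x) := by gcongr
      _ = _ := by rw [Real.exp_one_rpow]

/-- Superadditivity of the lower integral suffices for this direction, so the terms need not be
measurable. -/
theorem tsum_lintegral_le {X : Type*} [MeasurableSpace X] (μ : Measure X) (f : ℕ → X → ℝ≥0∞) :
    ∑' i, ∫⁻ x, f i x ∂μ ≤ ∫⁻ x, ∑' i, f i x ∂μ := by
  refine ENNReal.tsum_le_of_sum_range_le fun n => ?_
  calc ∑ i ∈ Finset.range n, ∫⁻ x, f i x ∂μ ≤ ∫⁻ x, ∑ i ∈ Finset.range n, f i x ∂μ := by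
        induction n with
        | zero => simp
        | succ n ih =>
          simp only [Finset.sum_range_succ]
          exact (add_le_add_left ih _).trans (le_lintegral_add _ _)
    _ ≤ _ := lintegral_mono fun x => ENNReal.sum_le_tsum _

/-! ### Weighted energies -/

/-- Growth by at least `δ` makes the last term dominate a geometric sum; the constant `S` is the
solution of `S / δ² + 1 = S`. -/
theorem sum_weight_sq_le {δ : ℝ} (hδ : 1 < δ) {w : ℕ → ℝ} (hw : ∀ j, 0 < w j)
    (h : ∀ j, δ * w j ≤ w (j + 1)) (n : ℕ) :
    ∑ j ∈ Finset.range (n + 1), w j ^ 2 ≤ δ ^ 2 / (δ ^ 2 - 1) * w n ^ 2 := by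
  have hd : 0 < δ ^ 2 - 1 := by nlinarith
  induction n with
  | zero =>
    rw [zero_add, Finset.sum_range_one]
    refine le_mul_of_one_le_left (sq_nonneg _) ?_
    rw [le_div_iff₀ hd]
    linarith
  | succ n ih =>
    rw [Finset.sum_range_succ]
    have h1 : δ ^ 2 * w n ^ 2 ≤ w (n + 1) ^ 2 := by
      rw [← mul_pow]
      exact pow_le_pow_left₀ (mul_nonneg (by linarith) (hw n).le) (h n) 2
    calc _ ≤ (δ ^ 2 * w n ^ 2) / (δ ^ 2 - 1) + w (n + 1) ^ 2 := by
          rw [mul_div_right_comm]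
          gcongr
      _ ≤ w (n + 1) ^ 2 / (δ ^ 2 - 1) + w (n + 1) ^ 2 := by gcongr
      _ = _ := by field_simp; ring

/-- The sum is dominated by its last term, and `w (i + 3) ≤ k ^ 3 * w i` returns to the index `i`,
whence `k ^ 6`. -/
theorem tsum_weight_sq_le {δ k : ℝ} (hδ : 1 < δ) {w : ℕ → ℝ} (hw : ∀ j, 0 < w j)
    (h : ∀ j, δ * w j ≤ w (j + 1) ∧ w (j + 1) ≤ k * w j) (i : ℕ) :
    (∑' j, if j ≤ i + 3 then ENNReal.ofReal (w j ^ 2) else 0) ≤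
      ENNReal.ofReal (δ ^ 2 / (δ ^ 2 - 1) * k ^ 6) * ENNReal.ofReal (w i ^ 2) := by
  have hd : 0 < δ ^ 2 - 1 := by nlinarith
  have hk : 0 ≤ k := by
    by_contra hk
    nlinarith [(h 0).2, hw 0, hw 1]
  have h3 : w (i + 3) ≤ k ^ 3 * w i := by
    calc w (i + 3) ≤ k * (k * (k * w i)) :=
          (h (i + 2)).2.trans (mul_le_mul_of_nonneg_left ((h (i + 1)).2.trans
            (mul_le_mul_of_nonneg_left (h i).2 hk)) hk)
      _ = _ := by ring
  rw [tsum_eq_sum (s := Finset.range (i + 3 + 1)) fun j hj => if_neg (by simpa using hj),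
    Finset.sum_congr rfl fun j hj => if_pos (Nat.lt_succ_iff.1 (Finset.mem_range.1 hj)),
    ← ENNReal.ofReal_sum_of_nonneg fun j _ => sq_nonneg _, ← ENNReal.ofReal_mul (by positivity)]
  refine ENNReal.ofReal_le_ofReal ((sum_weight_sq_le hδ hw (fun j => (h j).1) (i + 3)).trans ?_)
  calc δ ^ 2 / (δ ^ 2 - 1) * w (i + 3) ^ 2 ≤ δ ^ 2 / (δ ^ 2 - 1) * (k ^ 3 * w i) ^ 2 := by
        gcongr
        exact (hw _).le
    _ = _ := by ring

/-- The weighted energy `∑ w_λ² ‖Δ_λ f‖²`, with values in `[0, ∞]`. -/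
def energy (P : DyadicPartition) (w : ℕ → ℝ) (f : L2R) : ℝ≥0∞ :=
  ∑' j, ENNReal.ofReal (w j ^ 2) * ‖P.block j (toComplex f)‖ₑ ^ 2

theorem ofReal_weightedEnergy (P : DyadicPartition) (w : ℕ → ℝ) (f : L2R) (j : ℕ) :
    ENNReal.ofReal (weightedEnergy P w f j) =
      ENNReal.ofReal (w j ^ 2) * ‖P.block j (toComplex f)‖ₑ ^ 2 := by
  rw [weightedEnergy, ENNReal.ofReal_mul (sq_nonneg _), ENNReal.ofReal_pow (norm_nonneg _),
    ofReal_norm]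

theorem weightedEnergy_nonneg (P : DyadicPartition) (w : ℕ → ℝ) (f : L2R) (j : ℕ) :
    0 ≤ weightedEnergy P w f j := by
  unfold weightedEnergy
  positivity

/-- The differential inequality for the weighted energy, in integrated form. -/
theorem exists_energy_le (P : DyadicPartition) {δ : ℝ} (hδ : 1 < δ) (k : ℝ) :
    ∃ C : ℝ, 0 ≤ C ∧ ∀ {α s T : ℝ} {u : ℝ → L2R} {U : ℝ → Jet} {w : ℕ → ℝ},
      IsSolution α s T u U → 0 < α → 0 ≤ s → (∀ j, 0 < w j) →
      (∀ j, δ * w j ≤ w (j + 1) ∧ w (j + 1) ≤ k * w j) →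
      ∀ a ∈ Icc 0 T, ∀ b ∈ Icc 0 T, energy P w (u b) ≤ energy P w (u a) +
        ∫⁻ r in uIcc a b, ENNReal.ofReal (C * gradNorm (U r)) * energy P w (u r) := by
  obtain ⟨C, hC, hCle⟩ := exists_enorm_re_integral_nonlinear_le P
  have hd : 0 < δ ^ 2 - 1 := by nlinarith
  refine ⟨2 * (δ ^ 2 / (δ ^ 2 - 1) * k ^ 6) * C, by positivity, ?_⟩
  intro α s T u U w hu hα hs hw hwk a ha b hb
  have huc := hu.continuousInHs.continuousOn hs
  have hsub : uIcc a b ⊆ Icc 0 T := uIcc_subset_Icc ha hb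
  set N : ℕ → ℝ → ℝ≥0∞ := fun j r =>
    ‖∫ z, ((starRingEnd ℂ) (P.block j (toComplex (u r)) z) *
      nonlinear P j (toComplex (u r)) z).re‖ₑ with hN
  calc energy P w (u b)
      ≤ ∑' j, (ENNReal.ofReal (w j ^ 2) * ‖P.block j (toComplex (u a))‖ₑ ^ 2 +
          ∫⁻ r in uIcc a b, ENNReal.ofReal (w j ^ 2) * (2 * N j r)) := by
        refine ENNReal.tsum_le_tsum fun j => ?_
        rw [lintegral_const_mul' _ _ ENNReal.ofReal_ne_top, ← mul_add]
        gcongr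
        exact hu.enorm_block_sq_le P j hα huc ha hb
    _ ≤ energy P w (u a) +
          ∫⁻ r in uIcc a b, ∑' j, ENNReal.ofReal (w j ^ 2) * (2 * N j r) := by
        rw [ENNReal.tsum_add]
        gcongr
        · rfl
        · exact tsum_lintegral_le _ _
    _ ≤ _ := by
        refine add_le_add le_rfl (lintegral_mono_ae
          ((ae_restrict_iff' (measurableSet_uIcc (a := a) (b := b))).2 ?_))
        filter_upwards [hu.mem_W1Inf, hu.ae_eq] with r hr1 hr2 hr
        set n : ℕ → ℝ≥0∞ := fun i => ‖P.block i (toComplex (u r))‖ₑ ^ 2 with hn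
        set G : ℝ≥0∞ := ENNReal.ofReal (C * gradNorm (U r)) with hG
        set K : ℝ≥0∞ := ENNReal.ofReal (δ ^ 2 / (δ ^ 2 - 1) * k ^ 6) with hK
        calc ∑' j, ENNReal.ofReal (w j ^ 2) * (2 * N j r)
            ≤ ∑' j, ENNReal.ofReal (w j ^ 2) * (2 * (G * ∑' i, if j ≤ i + 3 then n i else 0)) := by
              gcongr with j
              exact hCle _ _ (hr1 (hsub hr)) (hr2 (hsub hr)) j
          _ = 2 * G * ∑' j, ∑' i, if j ≤ i + 3 then ENNReal.ofReal (w j ^ 2) * n i else 0 := by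
              rw [← ENNReal.tsum_mul_left]
              congr 1 with j
              rw [show ENNReal.ofReal (w j ^ 2) * (2 * (G * ∑' i, if j ≤ i + 3 then n i else 0)) =
                2 * G * (ENNReal.ofReal (w j ^ 2) * ∑' i, if j ≤ i + 3 then n i else 0) by ring,
                ← ENNReal.tsum_mul_left]
              simp only [mul_ite, mul_zero]
          -- Exchanging the sums collects, for each block `i`, the weights of all the blocks that it
          -- influences.
          _ = 2 * G * ∑' i, (∑' j, if j ≤ i + 3 then ENNReal.ofReal (w j ^ 2) else 0) * n i := by
              rw [ENNReal.tsum_comm]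
              congr 2 with i
              rw [← ENNReal.tsum_mul_right]
              simp only [ite_mul, zero_mul]
          _ ≤ 2 * G * ∑' i, K * ENNReal.ofReal (w i ^ 2) * n i := by
              gcongr with i
              exact tsum_weight_sq_le hδ hw hwk i
          _ = 2 * K * G * energy P w (u r) := by
              simp only [mul_assoc K]
              rw [ENNReal.tsum_mul_left, energy]
              ring
          _ = _ := by
              rw [hK, hG, mul_assoc _ C, ENNReal.ofReal_mul (p := 2 * _) (by positivity),
                ENNReal.ofReal_mul (p := 2) (by positivity), ENNReal.ofReal_ofNat]

/-- The geometric bound on `w` serves only to make the energy bounded on `[0, T]`: its terms are at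
most a constant times `((3/2)² / 8) ^ j = (9/32) ^ j`. The constant `D` does not enter the
conclusion. -/
theorem energy_le_of_le (P : DyadicPartition) {δ k C : ℝ} (hC : 0 ≤ C)
    (hCle : ∀ {α s T : ℝ} {u : ℝ → L2R} {U : ℝ → Jet} {w : ℕ → ℝ},
      IsSolution α s T u U → 0 < α → 0 ≤ s → (∀ j, 0 < w j) →
      (∀ j, δ * w j ≤ w (j + 1) ∧ w (j + 1) ≤ k * w j) →
      ∀ a ∈ Icc 0 T, ∀ b ∈ Icc 0 T, energy P w (u b) ≤ energy P w (u a) +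
        ∫⁻ r in uIcc a b, ENNReal.ofReal (C * gradNorm (U r)) * energy P w (u r))
    {α s T : ℝ} {u : ℝ → L2R} {U : ℝ → Jet} {w : ℕ → ℝ}
    (hu : IsSolution α s T u U) (hα : 0 < α) (hs : 3 / 2 ≤ s) (hw : ∀ j, 0 < w j)
    (hwk : ∀ j, δ * w j ≤ w (j + 1) ∧ w (j + 1) ≤ k * w j)
    {D : ℝ} (hD : ∀ j, w j ≤ D * (3 / 2) ^ j)
    {a b : ℝ} (ha : a ∈ Icc 0 T) (hb : b ∈ Icc 0 T) :
    energy P w (u b) ≤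
      ENNReal.ofReal (4 * Real.exp (2 * (C * ∫ r in uIcc a b, gradNorm (U r)))) *
        energy P w (u a) := by
  obtain ⟨c, hc, hcle⟩ := P.exists_enorm_block_sq_le
  obtain ⟨v, hv, huv⟩ := hu.continuousInHs
  obtain ⟨V, hV⟩ := isCompact_Icc.exists_bound_of_continuousOn hv
  have hgrad : IntegrableOn (fun r => gradNorm (U r)) (Icc 0 T) :=
    (hu.integrableOn.snd.fst.norm).add hu.integrableOn.snd.snd.norm
  rw [← integral_const_mul]
  refine gronwall (E := fun t => energy P w (u t))
    (B := ∑' j : ℕ, ENNReal.ofReal (D ^ 2 * c * V ^ 2 * (9 / 32) ^ j)) ?_ (fun t ht => ?_)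
    (hgrad.const_mul C) (fun r => mul_nonneg hC (gradNorm_nonneg _))
    (hCle hu hα (by linarith) hw hwk) ha hb
  · refine ((summable_geometric_of_lt_one (r := 9 / 32) (by norm_num)
      (by norm_num)).mul_left (D ^ 2 * c * V ^ 2)).tsum_ofReal_ne_top
  · refine ENNReal.tsum_le_tsum fun j => ?_
    calc ENNReal.ofReal (w j ^ 2) * ‖P.block j (toComplex (u t))‖ₑ ^ 2
        ≤ ENNReal.ofReal ((D * (3 / 2) ^ j) ^ 2) *
          (ENNReal.ofReal (c * (1 / 8) ^ j) * ENNReal.ofReal (V ^ 2)) := by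
          gcongr
          · exact (hw j).le
          · exact hD j
          · refine (hcle s _ _ hs (huv t ht) j).trans ?_
            gcongr
            rw [← ofReal_norm, ← ENNReal.ofReal_pow (norm_nonneg _)]
            exact ENNReal.ofReal_le_ofReal (pow_le_pow_left₀ (norm_nonneg _) (hV t ht) 2)
      _ = _ := by
          rw [← ENNReal.ofReal_mul (by positivity), ← ENNReal.ofReal_mul (by positivity)]
          congr 1
          rw [mul_pow, ← pow_mul, mul_comm j 2, pow_mul,
            show (9 / 32 : ℝ) = (3 / 2) ^ 2 * (1 / 8) by norm_num, mul_pow]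
          ring

/-! ### Truncated weights -/

/-- The weight `w`, continued geometrically with the ratio `δ` after the index `N`. -/
def truncWeight (w : ℕ → ℝ) (δ : ℝ) (N j : ℕ) : ℝ := w (min j N) * δ ^ (j - N)

theorem truncWeight_of_le {w : ℕ → ℝ} {δ : ℝ} {N j : ℕ} (h : j ≤ N) :
    truncWeight w δ N j = w j := by
  rw [truncWeight, min_eq_left h, Nat.sub_eq_zero_of_le h, pow_zero, mul_one]

theorem truncWeight_succ {w : ℕ → ℝ} {δ : ℝ} {N j : ℕ} (h : N ≤ j) :
    truncWeight w δ N (j + 1) = δ * truncWeight w δ N j := by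
  rw [truncWeight, truncWeight, min_eq_right h, min_eq_right (h.trans j.le_succ),
    Nat.succ_sub h, pow_succ]
  ring

theorem truncWeight_pos {w : ℕ → ℝ} (hw : ∀ j, 0 < w j) {δ : ℝ} (hδ : 0 < δ) (N j : ℕ) :
    0 < truncWeight w δ N j :=
  mul_pos (hw _) (pow_pos hδ _)

theorem truncWeight_ratio {w : ℕ → ℝ} (hw : ∀ j, 0 < w j) {δ k : ℝ} (hδ : 0 < δ) (hδk : δ ≤ k)
    (h : ∀ j, δ * w j ≤ w (j + 1) ∧ w (j + 1) ≤ k * w j) (N j : ℕ) :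
    δ * truncWeight w δ N j ≤ truncWeight w δ N (j + 1) ∧
      truncWeight w δ N (j + 1) ≤ k * truncWeight w δ N j := by
  rcases lt_or_ge j N with hj | hj
  · rw [truncWeight_of_le hj.le, truncWeight_of_le hj]
    exact h j
  · rw [truncWeight_succ hj]
    exact ⟨le_rfl, mul_le_mul_of_nonneg_right hδk (truncWeight_pos hw hδ N j).le⟩

theorem truncWeight_le {w : ℕ → ℝ} {δ : ℝ} (hδ : 0 < δ) (h : ∀ j, δ * w j ≤ w (j + 1)) (N j : ℕ) :
    truncWeight w δ N j ≤ w j := by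
  rcases le_total j N with hj | hj
  · rw [truncWeight_of_le hj]
  · induction j, hj using Nat.le_induction with
    | base => rw [truncWeight_of_le le_rfl]
    | succ j hj ih =>
      rw [truncWeight_succ hj]
      exact (mul_le_mul_of_nonneg_left ih hδ.le).trans (h j)

theorem truncWeight_le_geometric {w : ℕ → ℝ} (hw : ∀ j, 0 < w j) {δ : ℝ} (hδ : 1 < δ)
    (hδ' : δ ≤ 3 / 2) (h : ∀ j, δ * w j ≤ w (j + 1)) (N j : ℕ) :
    truncWeight w δ N j ≤ w N * (3 / 2) ^ j := by
  have hmono : Monotone w := monotone_nat_of_le_succ fun j => by nlinarith [h j, hw j]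
  refine mul_le_mul (hmono (min_le_right _ _)) ?_ (by positivity) (hw N).le
  calc δ ^ (j - N) ≤ (3 / 2) ^ (j - N) := by gcongr
    _ ≤ _ := pow_le_pow_right₀ (by norm_num) (Nat.sub_le _ _)

end BO2

end

/-! ### Removal of the truncation and conclusion. -/

theorem lemma6p5 (P : BO2.DyadicPartition) (δ k : ℝ) (hδ : 1 < δ) (hδk : δ < k) :
    ∃ C : ℝ, 0 < C ∧
      ∀ (α s T : ℝ), 0 < α → α ≤ 1 → 3 / 2 + (1 - α) / 4 < s → 0 < T →
      ∀ (u : ℝ → BO2.L2R) (U : ℝ → BO2.Jet), BO2.IsSolution α s T u U →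
      ∀ w : ℕ → ℝ, (∀ j, 0 < w j) → (∀ j, δ * w j ≤ w (j + 1) ∧ w (j + 1) ≤ k * w j) →
      Summable (BO2.weightedEnergy P w (u 0)) →
      ∀ τ ∈ Set.Icc 0 T, ∀ t ∈ Set.Icc 0 T,
        Summable (BO2.weightedEnergy P w (u t)) ∧
        ∑' j, BO2.weightedEnergy P w (u t) j ≤
          C * Real.exp (C * ∫ r in Set.uIcc τ t, BO2.gradNorm (U r)) *
            ∑' j, BO2.weightedEnergy P w (u τ) j := by
  -- The growth condition survives a smaller ratio, and a ratio at most `3/2` lets the `H^s` decay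
  -- of the blocks beat the continued weights.
  set δ' := min δ (3 / 2) with hδ'
  have h1 : 1 < δ' := lt_min hδ (by norm_num)
  have hδ'k : δ' ≤ k := (min_le_left _ _).trans hδk.le
  obtain ⟨C, hC, hCle⟩ := BO2.exists_energy_le P h1 k
  -- The prefactor `4` and the exponent `2 * C` of the Gronwall bound.
  refine ⟨max 4 (2 * C), lt_max_of_lt_left (by norm_num), ?_⟩
  intro α s T hα hα1 hs hT u U hu w hw hwk hsum
  have hwk' (j : ℕ) : δ' * w j ≤ w (j + 1) ∧ w (j + 1) ≤ k * w j :=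
    ⟨(mul_le_mul_of_nonneg_right (min_le_left _ _) (hw j).le).trans (hwk j).1, (hwk j).2⟩
  have hpos : 0 < δ' := by linarith
  have key : ∀ a ∈ Icc 0 T, ∀ b ∈ Icc 0 T, BO2.energy P w (u b) ≤
      ENNReal.ofReal (4 * Real.exp (2 * (C * ∫ r in uIcc a b, BO2.gradNorm (U r)))) *
        BO2.energy P w (u a) := by
    intro a ha b hb
    -- A partial sum up to `N` is unchanged when `w` is replaced by its truncation at `N`. On the
    -- right the truncated weight is at most `w`, since `w` itself grows at least by the ratio `δ'`.
    refine ENNReal.tsum_le_of_sum_range_le fun N => ?_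
    calc ∑ j ∈ Finset.range N,
          ENNReal.ofReal (w j ^ 2) * ‖P.block j (BO2.toComplex (u b))‖ₑ ^ 2
        = ∑ j ∈ Finset.range N, ENNReal.ofReal (BO2.truncWeight w δ' N j ^ 2) *
            ‖P.block j (BO2.toComplex (u b))‖ₑ ^ 2 :=
          Finset.sum_congr rfl fun j hj => by
            rw [BO2.truncWeight_of_le (Finset.mem_range.1 hj).le]
      _ ≤ BO2.energy P (BO2.truncWeight w δ' N) (u b) := ENNReal.sum_le_tsum _
      _ ≤ _ := BO2.energy_le_of_le P hC hCle hu hα (by linarith)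
          (BO2.truncWeight_pos hw hpos N) (BO2.truncWeight_ratio hw hpos hδ'k hwk' N)
          (BO2.truncWeight_le_geometric hw h1 (min_le_right _ _) (fun j => (hwk' j).1) N) ha hb
      _ ≤ _ := by
          gcongr
          refine ENNReal.tsum_le_tsum fun j => ?_
          gcongr
          · exact (BO2.truncWeight_pos hw hpos N j).le
          · exact BO2.truncWeight_le hpos (fun j => (hwk' j).1) N j
  have hE (t : ℝ) : BO2.energy P w (u t) =
      ∑' j, ENNReal.ofReal (BO2.weightedEnergy P w (u t) j) :=
    tsum_congr fun j => (BO2.ofReal_weightedEnergy P w (u t) j).symm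
  have h0 : BO2.energy P w (u 0) ≠ ⊤ := by
    rw [hE]
    exact hsum.tsum_ofReal_ne_top
  have hfin : ∀ t ∈ Icc 0 T, Summable (BO2.weightedEnergy P w (u t)) := fun t ht => by
    have : BO2.energy P w (u t) ≠ ⊤ := ne_top_of_le_ne_top
      -- The estimate from time `0` propagates finiteness to all times; only then can the inequality
      -- be read in `ℝ`.
      (ENNReal.mul_ne_top ENNReal.ofReal_ne_top h0) (key 0 ⟨le_rfl, hT.le⟩ t ht)
    rw [hE] at this
    simpa only [ENNReal.toReal_ofReal (BO2.weightedEnergy_nonneg P w (u t) _)] using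
      ENNReal.summable_toReal this
  intro τ hτ t ht
  refine ⟨hfin t ht, ?_⟩
  have hk := key τ hτ t ht
  rw [hE, hE, ← ENNReal.ofReal_tsum_of_nonneg (BO2.weightedEnergy_nonneg P w (u t)) (hfin t ht),
    ← ENNReal.ofReal_tsum_of_nonneg (BO2.weightedEnergy_nonneg P w (u τ)) (hfin τ hτ),
    ← ENNReal.ofReal_mul (by positivity), ENNReal.ofReal_le_ofReal_iff (mul_nonneg (by positivity)
      (tsum_nonneg (BO2.weightedEnergy_nonneg P w (u τ))))] at hk
  have hI : 0 ≤ ∫ r in uIcc τ t, BO2.gradNorm (U r) :=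
    integral_nonneg fun r => BO2.gradNorm_nonneg _
  refine hk.trans (mul_le_mul_of_nonneg_right ?_
    (tsum_nonneg (BO2.weightedEnergy_nonneg P w (u τ))))
  rw [← mul_assoc]
  gcongr
  · exact le_max_left _ _
  · exact le_max_right _ _
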